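/- **Setting.** Let $m\ge 16$ and $n\ge 1$ be integers, and let $A\in\mathbb R^{m\times m}$ and $B\in\mathbb R^{n\times n}$ be positive semidefinite matrices with $\operatorname{tr}(A)=m$, $B\neq 0$ and $\|B\|_F^2/\|B\|_2^2\ge \log m$. Let $Z_1,Z_2$ be independent random $n\times m$ matrices (for instance two independent copies of one ensemble), each having independent entries $Z_{ij}$ with $\mathbb E Z_{ij}=0$, $\operatorname{Var}(Z_{ij})=1$ and $\|Z_{ij}\|_{\psi_2}:=\inf\{t>0:\mathbb E\exp(Z_{ij}^2/t^2)\le 2\}\le K$. Let $$X=Z_1A^{1/2}+B^{1/2}Z_2,\qquad \hat\tau_B=\frac1{nm}\bigl(\|X\|_F^2-n\operatorname{tr}(A)\bigr)_+,\qquad \Delta=\frac1nX^TX-\hat\tau_BI_m-A .$$ Here $\|\cdot\|_2$ is the operator norm, $\|\cdot\|_F$ the Frobenius norm and $\|M\|_{\max}=\max_{i,j}|M_{ij}|$. Put $a_{\max}=\max_iA_{ii}$, $\tau_B=\operatorname{tr}(B)/n$, $D_0'=\|B\|_2^{1/2}+a_{\max}^{1/2}$, $D_1=\|A\|_F/\sqrt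 m+\|B\|_F/\sqrt n$ and, for a constant $C_0>0$, $$r_{m,n}=C_0K^2\sqrt{\frac{\log m}{n}},\qquad r_{m,m}=2C_0K^2\sqrt{\frac{\log m}{mn}},\qquad \psi_0=C_0K^2(\|B\|_2+a_{\max}).$$ **Lemma.** There is an absolute constant $C_0>0$ such that, for all $n,m,A,B,K,Z_1,Z_2$ as above, with probability at least $1-12/m^2$, $$\|\Delta\|_{\max}\le R:=8\bigl(\tau_B^{1/2}D_0'+a_{\max}\bigr)r_{m,n}+4C_0D_1r_{m,m}.$$ The bound $R$ is at most of the order $\psi_0\sqrt{\log m/n}$: there is an absolute constant $C>0$ with $$R\le C\,\psi_0\sqrt{\frac{\log m}{n}}\qquad\text{for all } n,m,A,B,K \text{ as above.}$$ It is exactly of this order when $\|B\|_2=O(\tau_B)$: for every $\kappa>0$ there is a constant $c>0$, depending only on $\kappa$, such that $R\ge c\,\psi_0\sqrt{\log m/n}$ for all $n,m,A,B,K$ as above with $\|B\|_2\le\kappa\,\tau_B$. -/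

import Mathlib

open MeasureTheory ProbabilityTheory
open scoped Matrix MatrixOrder ENNReal

noncomputable section

namespace KroneckerSum

/-- The `ψ₂`-norm `inf {t > 0 : 𝔼 exp (Y² / t²) ≤ 2}` of a real random variable, with values in
`[0, ∞]` (it is `∞` when no such `t` exists). -/
def psiTwoNorm {Ω : Type*} [MeasurableSpace Ω] (μ : Measure Ω) (Y : Ω → ℝ) : ℝ≥0∞ :=
  ⨅ (t : ℝ) (_ : 0 < t) (_ : ∫⁻ ω, ENNReal.ofReal (Real.exp (Y ω ^ 2 / t ^ 2)) ∂μ ≤ 2),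
    ENNReal.ofReal t

/-- A random `n × m` matrix with independent entries of mean `0`, variance `1` and `ψ₂`-norm
at most `K`. -/
structure IsSubgaussianEnsemble {Ω : Type*} [MeasurableSpace Ω] (μ : Measure Ω) {n m : ℕ}
    (K : ℝ) (Z : Ω → Matrix (Fin n) (Fin m) ℝ) : Prop where
  measurable : ∀ i j, Measurable fun ω => Z ω i j
  indep : iIndepFun (fun (p : Fin n × Fin m) ω => Z ω p.1 p.2) μ
  mean_zero : ∀ i j, ∫ ω, Z ω i j ∂μ = 0
  variance_one : ∀ i j, variance (fun ω => Z ω i j) μ = 1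
  psiTwoNorm_le : ∀ i j, psiTwoNorm μ (fun ω => Z ω i j) ≤ ENNReal.ofReal K

/-- Independence of two random matrices (seen as families of entries). -/
def IndepMatrix {Ω : Type*} [MeasurableSpace Ω] (μ : Measure Ω) {n m : ℕ}
    (Z₁ Z₂ : Ω → Matrix (Fin n) (Fin m) ℝ) : Prop :=
  IndepFun (fun ω (p : Fin n × Fin m) => Z₁ ω p.1 p.2)
    (fun ω (p : Fin n × Fin m) => Z₂ ω p.1 p.2) μ

/-- Operator norm `‖M‖₂` of a square matrix for the Euclidean norm. -/
def opNorm {p : ℕ} (M : Matrix (Fin p) (Fin p) ℝ) : ℝ :=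
  ‖Matrix.toEuclideanCLM (n := Fin p) (𝕜 := ℝ) M‖

/-- Frobenius norm. -/
def frobNorm {p q : ℕ} (M : Matrix (Fin p) (Fin q) ℝ) : ℝ :=
  Real.sqrt (∑ i, ∑ j, M i j ^ 2)

/-- Entrywise maximum norm. -/
def maxNorm {p q : ℕ} (M : Matrix (Fin p) (Fin q) ℝ) : ℝ :=
  ⨆ ij : Fin p × Fin q, |M ij.1 ij.2|

/-- Largest diagonal entry. -/
def diagMax {p : ℕ} (M : Matrix (Fin p) (Fin p) ℝ) : ℝ :=
  ⨆ i, M i i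

/-- Normalized trace `τ_M = tr(M) / p`. -/
def tau {p : ℕ} (M : Matrix (Fin p) (Fin p) ℝ) : ℝ :=
  M.trace / p

/-- The Kronecker sum model `X = Z₁ A^{1/2} + B^{1/2} Z₂`, with positive semidefinite square
roots. -/
def dataMatrix {n m : ℕ} (A : Matrix (Fin m) (Fin m) ℝ) (B : Matrix (Fin n) (Fin n) ℝ)
    (Z₁ Z₂ : Matrix (Fin n) (Fin m) ℝ) : Matrix (Fin n) (Fin m) ℝ :=
  Z₁ * CFC.sqrt A + CFC.sqrt B * Z₂

/-- The estimator `(1/m) (‖X‖_F² - n tr(A))₊` of `tr(B)`, given `trA = tr(A)`. -/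
def trHat {n m : ℕ} (trA : ℝ) (X : Matrix (Fin n) (Fin m) ℝ) : ℝ :=
  1 / m * max (frobNorm X ^ 2 - n * trA) 0

/-- `τ̂_B = (1/n) t̂r(B)`. -/
def tauHat {n m : ℕ} (trA : ℝ) (X : Matrix (Fin n) (Fin m) ℝ) : ℝ :=
  1 / n * trHat trA X

/-- The corrected Gram matrix `(1/n) Xᵀ X - τ̂_B I`. -/
def gammaHat {n m : ℕ} (trA : ℝ) (X : Matrix (Fin n) (Fin m) ℝ) : Matrix (Fin m) (Fin m) ℝ :=
  (1 / n : ℝ) • (Xᵀ * X) - tauHat trA X • (1 : Matrix (Fin m) (Fin m) ℝ)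

/-- Standing conditions on the sizes and the covariance parameters. -/
structure Conditions {n m : ℕ} (A : Matrix (Fin m) (Fin m) ℝ) (B : Matrix (Fin n) (Fin n) ℝ) :
    Prop where
  posSemidef_A : A.PosSemidef
  posSemidef_B : B.PosSemidef
  trace_A : A.trace = m
  sixteen_le : 16 ≤ m
  /-- In particular `B ≠ 0`, as `0 / 0 = 0 < log m`. -/
  stableRank_B : Real.log m ≤ frobNorm B ^ 2 / opNorm B ^ 2

/-- `r_{m,n} = C₀ K² √(log m / n)`. -/
def rmn (C₀ K : ℝ) (n m : ℕ) : ℝ :=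
  C₀ * K ^ 2 * Real.sqrt (Real.log m / n)

/-- `r_{m,m} = 2 C₀ K² √(log m / (m n))`. -/
def rmm (C₀ K : ℝ) (n m : ℕ) : ℝ :=
  2 * C₀ * K ^ 2 * Real.sqrt (Real.log m / (m * n))

/-- `D₀' = ‖B‖₂^{1/2} + a_max^{1/2}`. -/
def D0' {n m : ℕ} (A : Matrix (Fin m) (Fin m) ℝ) (B : Matrix (Fin n) (Fin n) ℝ) : ℝ :=
  Real.sqrt (opNorm B) + Real.sqrt (diagMax A)

/-- `D₁ = ‖A‖_F / √m + ‖B‖_F / √n`. -/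
def D1 {n m : ℕ} (A : Matrix (Fin m) (Fin m) ℝ) (B : Matrix (Fin n) (Fin n) ℝ) : ℝ :=
  frobNorm A / Real.sqrt m + frobNorm B / Real.sqrt n

/-- `ψ₀ = C₀ K² (‖B‖₂ + a_max)`. -/
def psi0 {n m : ℕ} (C₀ K : ℝ) (A : Matrix (Fin m) (Fin m) ℝ) (B : Matrix (Fin n) (Fin n) ℝ) :
    ℝ :=
  C₀ * K ^ 2 * (opNorm B + diagMax A)

/-- `8 (τ_B^{1/2} D₀' + a_max) r_{m,n} + 4 C₀ D₁ r_{m,m}`. -/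
def deviationBound {n m : ℕ} (C₀ K : ℝ) (A : Matrix (Fin m) (Fin m) ℝ)
    (B : Matrix (Fin n) (Fin n) ℝ) : ℝ :=
  8 * (Real.sqrt (tau B) * D0' A B + diagMax A) * rmn C₀ K n m + 4 * C₀ * D1 A B * rmm C₀ K n m

end KroneckerSum

end

noncomputable section

namespace KroneckerSum

/-! Fix a vector `u` and put `w = A^{1/2} u`. Then `n uᵀ(XᵀX/n - A - τ_B I)u` splits into three
fluctuations: `|Z₁w|² - n|w|²`, twice the bilinear form `⟨Z₁w, B^{1/2}Z₂u⟩`, and `(Z₂u)ᵀB(Z₂u) -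
|u|² tr B`. The coordinates of `Z₁w` and of `Z₂u` are independent and sub-Gaussian, with proxies
`8K²|w|²` and `8K²|u|²`, and the two vectors are independent of each other. So each term obeys a
Hanson-Wright bound (`measure_quadratic_deviation_le`, `measure_bilinear_deviation_le`).

Hanson-Wright has a purely Gaussian tail up to level `T` when `T‖M‖² ≤ ‖M‖_F²`. For `T = log m` and
`M = I`, `B`, `B^{1/2}` this reads `log m ≤ n`, `log m ‖B‖² ≤ ‖B‖_F²` and `log m ‖B‖ ≤ tr B`, all
consequences of the stable rank condition.

Hanson-Wright itself comes from exponential moments. The off-diagonal part is decoupled into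
bilinear forms of independent vectors; conditioning on one vector leaves `exp(θ|Ph|²)`, which a
Gaussian linearization reduces to chi-square moments. The diagonal part is a sum of independent
centered squares. Exponential moments are taken in `[0, ∞]`, so Tonelli applies without
integrability conditions.

Polarization over the `m²` vectors `e_i + e_j` turns quadratic bounds into entrywise ones. Replacing
`τ_B` by its estimator at most doubles the error, since the estimator's error is at most the mean
diagonal deviation in absolute value. The term `D₁ r_{m,m}` is not needed for the probability bound;
it is only kept as nonnegative slack. -/

/-- The exponential moment `𝔼 exp X`, with values in `[0, ∞]`. -/
def expMoment {Ω : Type*} [MeasurableSpace Ω] (μ : Measure Ω) (X : Ω → ℝ) : ℝ≥0∞ :=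
  ∫⁻ ω, ENNReal.ofReal (Real.exp (X ω)) ∂μ

/-- A measurable random variable is sub-Gaussian with variance proxy `c`
if `𝔼 exp (t X) ≤ exp (c t² / 2)` for all real `t`. -/
structure IsSubGaussian {Ω : Type*} [MeasurableSpace Ω] (μ : Measure Ω) (c : ℝ) (X : Ω → ℝ) :
    Prop where
  measurable : Measurable X
  expMoment_le : ∀ t : ℝ, expMoment μ (fun ω => t * X ω) ≤ ENNReal.ofReal (Real.exp (c * t ^ 2 / 2))

/-! ### Exponential moments of independent sums -/

section Moments

variable {Ω : Type*} [MeasurableSpace Ω] {μ : Measure Ω}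

lemma expMoment_mono {X Y : Ω → ℝ} (h : ∀ ω, X ω ≤ Y ω) : expMoment μ X ≤ expMoment μ Y :=
  lintegral_mono fun ω => ENNReal.ofReal_le_ofReal (Real.exp_le_exp.2 (h ω))

lemma expMoment_sum {ι : Type*} [Fintype ι] {X : ι → Ω → ℝ} (hX : ∀ i, Measurable (X i))
    (hind : iIndepFun X μ) :
    expMoment μ (fun ω => ∑ i, X i ω) = ∏ i, expMoment μ (X i) := by
  unfold expMoment
  rw [← lintegral_prod_eq_prod_lintegral_of_indepFun Finset.univ
    (fun i ω => ENNReal.ofReal (Real.exp (X i ω)))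
    (hind.comp (fun _ x => ENNReal.ofReal (Real.exp x)) (fun _ => by fun_prop))
    (fun i => by have := hX i; fun_prop)]
  refine lintegral_congr fun ω => ?_
  rw [Real.exp_sum, ENNReal.ofReal_prod_of_nonneg fun i _ => (Real.exp_pos _).le]

lemma expMoment_sum_le {ι : Type*} [Fintype ι] {X : ι → Ω → ℝ} (hX : ∀ i, Measurable (X i))
    (hind : iIndepFun X μ) {b : ι → ℝ}
    (hb : ∀ i, expMoment μ (X i) ≤ ENNReal.ofReal (Real.exp (b i))) :
    expMoment μ (fun ω => ∑ i, X i ω) ≤ ENNReal.ofReal (Real.exp (∑ i, b i)) := by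
  rw [expMoment_sum hX hind, Real.exp_sum,
    ENNReal.ofReal_prod_of_nonneg fun i _ => (Real.exp_pos _).le]
  exact Finset.prod_le_prod' fun i _ => hb i

lemma IsSubGaussian.mono {c c' : ℝ} {X : Ω → ℝ} (h : IsSubGaussian μ c X) (hc : c ≤ c') :
    IsSubGaussian μ c' X :=
  ⟨h.measurable, fun t => (h.expMoment_le t).trans (ENNReal.ofReal_le_ofReal
    (Real.exp_le_exp.2 (by gcongr)))⟩

lemma IsSubGaussian.const_mul {c : ℝ} {X : Ω → ℝ} (h : IsSubGaussian μ c X) (a : ℝ) :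
    IsSubGaussian μ (c * a ^ 2) (fun ω => a * X ω) := by
  refine ⟨h.measurable.const_mul a, fun t => ?_⟩
  have := h.expMoment_le (t * a)
  simp only [mul_assoc, mul_pow] at this ⊢
  convert this using 4
  ring

lemma IsSubGaussian.sum {ι : Type*} [Fintype ι] {c : ι → ℝ} {X : ι → Ω → ℝ}
    (h : ∀ i, IsSubGaussian μ (c i) (X i)) (hind : iIndepFun X μ) :
    IsSubGaussian μ (∑ i, c i) (fun ω => ∑ i, X i ω) := by
  refine ⟨Finset.measurable_fun_sum _ fun i _ => (h i).measurable, fun t => ?_⟩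
  have := expMoment_sum_le (μ := μ) (X := fun i ω => t * X i ω)
    (fun i => (h i).measurable.const_mul t)
    (hind.comp (fun _ x => t * x) (fun _ => by fun_prop)) (fun i => (h i).expMoment_le t)
  convert this using 3
  · rw [Finset.mul_sum]
  · simp_rw [Finset.sum_mul, Finset.sum_div]

lemma IsSubGaussian.linearCombination {ι : Type*} [Fintype ι] {c : ℝ} {X : ι → Ω → ℝ}
    (h : ∀ i, IsSubGaussian μ c (X i)) (hind : iIndepFun X μ) (a : ι → ℝ) :
    IsSubGaussian μ (c * ∑ i, a i ^ 2) (fun ω => ∑ i, a i * X i ω) := by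
  rw [Finset.mul_sum]
  exact IsSubGaussian.sum (fun i => (h i).const_mul (a i))
    (hind.comp (fun i x => a i * x) (fun _ => by fun_prop))

lemma expMoment_linearCombination_le {ι : Type*} [Fintype ι] {c : ℝ} {X : ι → Ω → ℝ}
    (h : ∀ i, IsSubGaussian μ c (X i)) (hind : iIndepFun X μ) (a : ι → ℝ) :
    expMoment μ (fun ω => ∑ i, a i * X i ω) ≤
      ENNReal.ofReal (Real.exp (c * (∑ i, a i ^ 2) / 2)) := by
  simpa using (IsSubGaussian.linearCombination h hind a).expMoment_le 1

end Moments

/-! ### Gaussian and chi-square exponential moments -/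

section Gaussian

lemma expMoment_gaussianReal_mul (a : ℝ) :
    expMoment (gaussianReal 0 1) (fun x => a * x) = ENNReal.ofReal (Real.exp (a ^ 2 / 2)) := by
  have h := mgf_gaussianReal (μ := 0) (v := 1) (p := gaussianReal 0 1) (X := id) (by simp) a
  unfold expMoment
  rw [← ofReal_integral_eq_lintegral_ofReal]
  · simp only [mgf, id] at h
    rw [h]; simp
  · exact integrable_exp_mul_gaussianReal a
  · exact ae_of_all _ fun _ => (Real.exp_pos _).le

lemma expMoment_gaussianReal_sq_le {a : ℝ} (h0 : 0 ≤ a) (h1 : a ≤ 1 / 4) :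
    expMoment (gaussianReal 0 1) (fun x => a * x ^ 2) ≤ ENNReal.ofReal (Real.exp (2 * a)) := by
  have hb : 0 < 1 / 2 - a := by linarith
  unfold expMoment
  rw [gaussianReal_of_var_ne_zero 0 one_ne_zero, lintegral_withDensity_eq_lintegral_mul _
    (measurable_gaussianPDF 0 1) (by fun_prop)]
  have : ∀ x : ℝ, (gaussianPDF 0 1 * fun x => ENNReal.ofReal (Real.exp (a * x ^ 2))) x
      = ENNReal.ofReal ((√(2 * Real.pi))⁻¹ * Real.exp (-(1 / 2 - a) * x ^ 2)) := by
    intro x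
    simp only [Pi.mul_apply, gaussianPDF, gaussianPDFReal]
    rw [← ENNReal.ofReal_mul (by positivity), mul_assoc, ← Real.exp_add]
    simp only [NNReal.coe_one, mul_one, sub_zero]
    ring_nf
  simp_rw [this]
  rw [← ofReal_integral_eq_lintegral_ofReal ((integrable_exp_neg_mul_sq hb).const_mul _)
    (ae_of_all _ fun _ => by positivity), integral_const_mul, integral_gaussian]
  apply ENNReal.ofReal_le_ofReal
  rw [← Real.sqrt_inv, ← Real.sqrt_mul (by positivity)]
  apply Real.sqrt_le_iff.2 ⟨by positivity, ?_⟩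
  rw [← Real.exp_nat_mul]
  -- The exact moment is `(1 - 2a)^{-1/2}`. After squaring, the claim follows from `(1 + 4a)(1 - 2a)
  -- ≥ 1`, which for `a ≥ 0` is exactly `a ≤ 1/4`.
  have e1 : (2 * Real.pi)⁻¹ * (Real.pi / (1 / 2 - a)) = 1 / (1 - 2 * a) := by
    have := Real.pi_pos
    field_simp
  rw [e1, div_le_iff₀ (by linarith)]
  have := Real.add_one_le_exp (((2 : ℕ) : ℝ) * (2 * a))
  push_cast at this ⊢
  nlinarith

end Gaussian

/-! ### Diagonalization of `|Px|²` -/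

section Spectral

variable {ι κ : Type*} [Fintype ι] [Fintype κ]

/-- Spectral decomposition of the quadratic form `x ↦ |P x|²`. -/
lemma exists_spectral_sq_mulVec [DecidableEq ι] (P : Matrix κ ι ℝ) {L : ℝ}
    (hL : ∀ x : ι → ℝ, ∑ k, (P *ᵥ x) k ^ 2 ≤ L * ∑ i, x i ^ 2) :
    ∃ (l : ι → ℝ) (U : Matrix ι ι ℝ), (∀ i, 0 ≤ l i) ∧ (∀ i, l i ≤ L) ∧ Uᵀ * U = 1 ∧
      (∀ x : ι → ℝ, ∑ k, (P *ᵥ x) k ^ 2 = ∑ i, l i * (Uᵀ *ᵥ x) i ^ 2) ∧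
      ∑ i, l i = ∑ k, ∑ i, P k i ^ 2 := by
  have hH : (Pᵀ * P).IsHermitian := by
    have := Matrix.isHermitian_conjTranspose_mul_self P
    rwa [Matrix.conjTranspose_eq_transpose_of_trivial] at this
  set U : Matrix ι ι ℝ := (hH.eigenvectorUnitary : Matrix ι ι ℝ) with hU
  have hUU : Uᵀ * U = 1 := by
    have := Unitary.coe_star_mul_self hH.eigenvectorUnitary
    rwa [Matrix.star_eq_conjTranspose, Matrix.conjTranspose_eq_transpose_of_trivial] at this
  have hsp : Pᵀ * P = U * Matrix.diagonal hH.eigenvalues * Uᵀ := by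
    have := hH.spectral_theorem
    rw [Unitary.conjStarAlgAut_apply, Matrix.star_eq_conjTranspose,
      Matrix.conjTranspose_eq_transpose_of_trivial] at this
    exact this
  have hq : ∀ x : ι → ℝ, ∑ k, (P *ᵥ x) k ^ 2 = ∑ i, hH.eigenvalues i * (Uᵀ *ᵥ x) i ^ 2 := by
    intro x
    have h1 : ∑ k, (P *ᵥ x) k ^ 2 = x ⬝ᵥ ((Pᵀ * P) *ᵥ x) := by
      rw [← Matrix.mulVec_mulVec, Matrix.dotProduct_mulVec, Matrix.vecMul_transpose]
      simp [dotProduct, sq]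
    rw [h1, congrArg (fun Q => x ⬝ᵥ (Q *ᵥ x)) hsp, ← Matrix.mulVec_mulVec,
      ← Matrix.mulVec_mulVec, Matrix.dotProduct_mulVec,
      ← Matrix.mulVec_transpose]
    simp only [dotProduct, Matrix.mulVec_diagonal]
    exact Finset.sum_congr rfl fun i _ => by ring
  -- Testing the form on the eigenvectors gives both `0 ≤ l i` and `l i ≤ L`.
  have hcol : ∀ i, ∑ k, (P *ᵥ (U *ᵥ Pi.single i 1)) k ^ 2 = hH.eigenvalues i := by
    intro i
    rw [hq, Matrix.mulVec_mulVec, hUU, Matrix.one_mulVec]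
    simp [Pi.single_apply]
  refine ⟨hH.eigenvalues, U, fun i => ?_, fun i => ?_, hUU, hq, ?_⟩
  · rw [← hcol]; positivity
  · rw [← hcol]
    refine (hL _).trans_eq ?_
    have : ∑ j, (U *ᵥ Pi.single i 1) j ^ 2 = 1 := by
      have h2 := congrFun (congrFun hUU i) i
      simpa [Matrix.mul_apply, sq] using h2
    rw [this, mul_one]
  · have := hH.trace_eq_sum_eigenvalues
    simp only [RCLike.ofReal_real_eq_id, id] at this
    rw [← this, Matrix.trace, Finset.sum_comm]
    simp [Matrix.mul_apply, sq]

end Spectral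

/-! ### Exponential moments of `|Ph|²` by Gaussian linearization -/

section QuadraticMoment

variable {Ω : Type*} [MeasurableSpace Ω] {μ : Measure Ω}

/-- Exponential moments of `|P h|²` for a vector `h` of independent sub-Gaussian variables. -/
lemma expMoment_sq_mulVec_le {ι κ : Type*} [Fintype ι] [Fintype κ] {c L θ : ℝ}
    {h : ι → Ω → ℝ} (hh : ∀ i, IsSubGaussian μ c (h i)) (hind : iIndepFun h μ)
    (P : Matrix κ ι ℝ) (hL : ∀ x : ι → ℝ, ∑ k, (P *ᵥ x) k ^ 2 ≤ L * ∑ i, x i ^ 2)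
    (hc : 0 ≤ c) (hθ : 0 ≤ θ) (hθL : c * θ * L ≤ 1 / 4) :
    expMoment μ (fun ω => θ * ∑ k, (P *ᵥ fun i => h i ω) k ^ 2) ≤
      ENNReal.ofReal (Real.exp (2 * c * θ * ∑ k, ∑ i, P k i ^ 2)) := by
  classical
  have := hind.isProbabilityMeasure
  obtain ⟨l, U, hl0, hlL, hUU, hq, htr⟩ := exists_spectral_sq_mulVec P hL
  have hm : ∀ i, Measurable (h i) := fun i => (hh i).measurable
  -- With `s_i² / 2 = θ l_i`, the Gaussian moment `𝔼 exp(s_i y_i γ_i)` equals `exp(θ l_i y_i²)`: an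
  -- auxiliary Gaussian `γ` makes the exponent linear in `h`.
  set s : ι → ℝ := fun i => √(2 * θ * l i) with hs
  have hs2 : ∀ i, s i ^ 2 = 2 * θ * l i := fun i =>
    Real.sq_sqrt (mul_nonneg (mul_nonneg zero_le_two hθ) (hl0 i))
  let ν : Measure (ι → ℝ) := Measure.pi fun _ => gaussianReal 0 1
  have hcoord : iIndepFun (fun (i : ι) (γ : ι → ℝ) => γ i) ν :=
    iIndepFun_pi (X := fun _ x => x) (fun _ => aemeasurable_id)
  have hmarg : ∀ (i : ι) (f : ℝ → ℝ), Measurable f →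
      expMoment ν (fun γ => f (γ i)) = expMoment (gaussianReal 0 1) f := by
    intro i f hf
    unfold expMoment
    exact (measurePreserving_eval (fun _ : ι => gaussianReal 0 1) i).lintegral_comp
      (f := fun x => ENNReal.ofReal (Real.exp (f x))) (by fun_prop)
  have hlin : ∀ y : ι → ℝ, ENNReal.ofReal (Real.exp (θ * ∑ i, l i * y i ^ 2)) =
      expMoment ν (fun γ => ∑ i, s i * y i * γ i) := by
    intro y
    rw [expMoment_sum (X := fun i (γ : ι → ℝ) => s i * y i * γ i) (fun i => by fun_prop)
      (hcoord.comp (fun i x => s i * y i * x) (fun i => by fun_prop))]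
    rw [Finset.mul_sum, Real.exp_sum, ENNReal.ofReal_prod_of_nonneg fun i _ => (Real.exp_pos _).le]
    refine Finset.prod_congr rfl fun i _ => ?_
    rw [hmarg i (fun x => s i * y i * x) (by fun_prop), expMoment_gaussianReal_mul]
    congr 2
    rw [mul_pow, hs2]; ring
  have hnorm : ∀ z : ι → ℝ, ∑ i, (U *ᵥ z) i ^ 2 = ∑ i, z i ^ 2 := by
    intro z
    have h1 : ∀ w : ι → ℝ, ∑ i, w i ^ 2 = w ⬝ᵥ w := fun w => by simp [dotProduct, sq]
    rw [h1, h1, Matrix.dotProduct_mulVec, Matrix.vecMul_mulVec, ← Matrix.dotProduct_mulVec,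
      hUU, Matrix.one_mulVec]
  calc expMoment μ (fun ω => θ * ∑ k, (P *ᵥ fun i => h i ω) k ^ 2)
      = ∫⁻ ω, ∫⁻ γ, ENNReal.ofReal (Real.exp
          (∑ i, s i * (Uᵀ *ᵥ fun i => h i ω) i * γ i)) ∂ν ∂μ := by
        unfold expMoment
        refine lintegral_congr fun ω => ?_
        beta_reduce
        rw [hq, hlin]; rfl
    _ = ∫⁻ γ, ∫⁻ ω, ENNReal.ofReal (Real.exp
          (∑ i, s i * (Uᵀ *ᵥ fun i => h i ω) i * γ i)) ∂μ ∂ν := by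
        refine lintegral_lintegral_swap ?_
        simp only [Matrix.mulVec, dotProduct, Function.uncurry_def]
        fun_prop
    -- For fixed `γ` the exponent is the linear form in `h` with coefficients `U(s γ)`.
    -- Sub-Gaussianity bounds its moment, and orthogonality of `U` removes the rotation.
    _ ≤ ∫⁻ γ, ENNReal.ofReal (Real.exp (∑ i, c * θ * l i * γ i ^ 2)) ∂ν := by
        refine lintegral_mono fun γ => ?_
        have := expMoment_linearCombination_le hh hind (U *ᵥ fun i => s i * γ i)
        rw [hnorm] at this
        convert this using 3
        · unfold expMoment
          refine lintegral_congr fun ω => ?_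
          congr 2
          have h2 := Matrix.dotProduct_mulVec (fun i => s i * γ i) Uᵀ (fun i => h i ω)
          rw [Matrix.vecMul_transpose] at h2
          simp only [dotProduct] at h2
          beta_reduce
          rw [← h2]
          exact Finset.sum_congr rfl fun i _ => by ring
        · rw [Finset.mul_sum, Finset.sum_div]
          refine Finset.sum_congr rfl fun i _ => ?_
          rw [mul_pow, hs2]; ring
    _ ≤ ENNReal.ofReal (Real.exp (∑ i, 2 * (c * θ * l i))) := by
        refine expMoment_sum_le (X := fun i (γ : ι → ℝ) => c * θ * l i * γ i ^ 2)
          (fun i => by fun_prop)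
          (hcoord.comp (fun i x => c * θ * l i * x ^ 2) (fun i => by fun_prop)) fun i => ?_
        rw [hmarg i (fun x => c * θ * l i * x ^ 2) (by fun_prop)]
        refine expMoment_gaussianReal_sq_le (mul_nonneg (mul_nonneg hc hθ) (hl0 i)) ?_
        exact (mul_le_mul_of_nonneg_left (hlL i) (mul_nonneg hc hθ)).trans hθL
    _ = _ := by
        rw [← htr, Finset.mul_sum]
        congr 2
        exact Finset.sum_congr rfl fun i _ => by ring

end QuadraticMoment

/-! ### Bilinear forms in two independent vectors -/

section Bilinear

variable {Ω : Type*} [MeasurableSpace Ω] {μ : Measure Ω}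

lemma lintegral_of_indepFun {α β : Type*} [MeasurableSpace α] [MeasurableSpace β]
    [IsProbabilityMeasure μ] {F : Ω → α} {G : Ω → β} (hF : Measurable F) (hG : Measurable G)
    (hind : IndepFun F G μ) {φ : α × β → ℝ≥0∞} (hφ : Measurable φ) :
    ∫⁻ ω, φ (F ω, G ω) ∂μ = ∫⁻ ω, ∫⁻ ω', φ (F ω, G ω') ∂μ ∂μ := by
  have : IsProbabilityMeasure (μ.map F) := Measure.isProbabilityMeasure_map hF.aemeasurable
  have : IsProbabilityMeasure (μ.map G) := Measure.isProbabilityMeasure_map hG.aemeasurable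
  rw [← lintegral_map (f := φ) hφ (hF.prodMk hG),
    (indepFun_iff_map_prod_eq_prod_map_map hF.aemeasurable hG.aemeasurable).1 hind,
    lintegral_prod _ hφ.aemeasurable, lintegral_map hφ.lintegral_prod_right' hF]
  refine lintegral_congr fun ω => ?_
  rw [lintegral_map (by fun_prop) hG]

/-- Exponential moments of a bilinear form in two independent sub-Gaussian vectors. -/
lemma expMoment_bilinear_le {ι κ : Type*} [Fintype ι] [Fintype κ] {c d L t : ℝ}
    {g : κ → Ω → ℝ} {h : ι → Ω → ℝ} (hg : ∀ k, IsSubGaussian μ d (g k)) (hgi : iIndepFun g μ)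
    (hh : ∀ i, IsSubGaussian μ c (h i)) (hhi : iIndepFun h μ)
    (hgh : IndepFun (fun ω k => g k ω) (fun ω i => h i ω) μ)
    (P : Matrix κ ι ℝ) (hL : ∀ x : ι → ℝ, ∑ k, (P *ᵥ x) k ^ 2 ≤ L * ∑ i, x i ^ 2)
    (hc : 0 ≤ c) (hd : 0 ≤ d) (htL : c * d * t ^ 2 * L ≤ 1 / 2) :
    expMoment μ (fun ω => t * ∑ k, g k ω * (P *ᵥ fun i => h i ω) k) ≤
      ENNReal.ofReal (Real.exp (c * d * t ^ 2 * ∑ k, ∑ i, P k i ^ 2)) := by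
  have := hgi.isProbabilityMeasure
  have hgm : Measurable fun ω k => g k ω := measurable_pi_lambda _ fun k => (hg k).measurable
  have hhm : Measurable fun ω i => h i ω := measurable_pi_lambda _ fun i => (hh i).measurable
  have hφ : Measurable fun p : (ι → ℝ) × (κ → ℝ) =>
      ENNReal.ofReal (Real.exp (t * ∑ k, p.2 k * (P *ᵥ p.1) k)) := by
    simp only [Matrix.mulVec, dotProduct]
    fun_prop
  calc expMoment μ (fun ω => t * ∑ k, g k ω * (P *ᵥ fun i => h i ω) k)
      = ∫⁻ ω, ∫⁻ ω', ENNReal.ofReal (Real.exp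
          (t * ∑ k, g k ω' * (P *ᵥ fun i => h i ω) k)) ∂μ ∂μ :=
        lintegral_of_indepFun hhm hgm hgh.symm hφ
    -- With `h` frozen the form is linear in `g`, and its moment is at most `exp(d t² |Ph|² / 2)`.
    _ ≤ expMoment μ (fun ω => d * t ^ 2 / 2 * ∑ k, (P *ᵥ fun i => h i ω) k ^ 2) := by
        refine lintegral_mono fun ω => ?_
        have := expMoment_linearCombination_le hg hgi (fun k => t * (P *ᵥ fun i => h i ω) k)
        unfold expMoment at this
        convert this using 4
        · beta_reduce
          rw [Finset.mul_sum]
          exact congrArg Real.exp (Finset.sum_congr rfl fun _ _ => by ring)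
        · simp only [mul_pow, ← Finset.mul_sum]
          ring
    _ ≤ ENNReal.ofReal (Real.exp (2 * c * (d * t ^ 2 / 2) * ∑ k, ∑ i, P k i ^ 2)) :=
        expMoment_sq_mulVec_le hh hhi P hL hc (by positivity) (by linarith)
    _ = _ := by congr 3; ring

end Bilinear

/-! ### Decoupling of the off-diagonal part -/

section Decoupling

variable {ι : Type*} [Fintype ι] [DecidableEq ι]

/-- Toggling the membership of a point is an involution on subsets. Toggling `j` shows that half of
them avoid `j`; toggling `i` shows that half of those contain `i`. -/
lemma sum_finset_separating {i j : ι} (hij : i ≠ j) :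
    ∑ S : Finset ι, (if i ∈ S then (1 : ℝ) else 0) * (if j ∈ S then 0 else 1) =
      2 ^ Fintype.card ι / 4 := by
  have flip : ∀ (a : ι) (f : Finset ι → ℝ), ∑ S, f (symmDiff S {a}) = ∑ S, f S := fun a f =>
    Equiv.sum_comp (Function.Involutive.toPerm (fun S : Finset ι => symmDiff S {a})
      (symmDiff_left_involutive {a})) f
  have h1 := flip i fun S => (if i ∈ S then (1 : ℝ) else 0) * (if j ∈ S then 0 else 1)
  have h2 := flip j fun S => (if j ∈ S then (0 : ℝ) else 1)
  have e1 : ∑ S : Finset ι, ((if i ∈ S then (1 : ℝ) else 0) * (if j ∈ S then 0 else 1) +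
      (if i ∈ symmDiff S {i} then (1 : ℝ) else 0) * (if j ∈ symmDiff S {i} then 0 else 1)) =
      ∑ S : Finset ι, (if j ∈ S then (0 : ℝ) else 1) := by
    refine Finset.sum_congr rfl fun S _ => ?_
    by_cases hi : i ∈ S <;> by_cases hj : j ∈ S <;>
      simp [Finset.mem_symmDiff, hi, hj, hij.symm]
  have e2 : ∑ S : Finset ι, ((if j ∈ S then (0 : ℝ) else 1) +
      (if j ∈ symmDiff S {j} then (0 : ℝ) else 1)) = ∑ S : Finset ι, 1 := by
    refine Finset.sum_congr rfl fun S _ => ?_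
    by_cases hj : j ∈ S <;> simp [Finset.mem_symmDiff, hj]
  rw [Finset.sum_add_distrib] at e1 e2
  have e3 : ∑ S : Finset ι, (1 : ℝ) = 2 ^ Fintype.card ι := by simp
  linarith

/-- The off-diagonal part of a quadratic form as an average of decoupled bilinear forms. -/
lemma offDiag_eq_average (M : Matrix ι ι ℝ) (x : ι → ℝ) :
    ∑ i, ∑ j, (if i = j then 0 else M i j * x i * x j) =
      ∑ S : Finset ι, ((2 : ℝ) ^ Fintype.card ι)⁻¹ * (4 * ∑ i, (if i ∈ S then x i else 0) *
        (M *ᵥ fun j => if j ∈ S then 0 else x j) i) := by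
  have key : ∀ S : Finset ι, ∑ i, (if i ∈ S then x i else 0) *
        (M *ᵥ fun j => if j ∈ S then 0 else x j) i = ∑ i, ∑ j, M i j * x i * x j *
          ((if i ∈ S then (1 : ℝ) else 0) * (if j ∈ S then 0 else 1)) := by
    intro S
    refine Finset.sum_congr rfl fun i _ => ?_
    simp only [Matrix.mulVec, dotProduct, Finset.mul_sum]
    refine Finset.sum_congr rfl fun j _ => ?_
    split_ifs <;> ring
  have hswap : ∑ S : Finset ι, ∑ i, ∑ j, M i j * x i * x j *
      ((if i ∈ S then (1 : ℝ) else 0) * (if j ∈ S then 0 else 1)) =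
      ∑ i, ∑ j, M i j * x i * x j *
        ∑ S : Finset ι, ((if i ∈ S then (1 : ℝ) else 0) * (if j ∈ S then 0 else 1)) := by
    rw [Finset.sum_comm]
    refine Finset.sum_congr rfl fun i _ => ?_
    rw [Finset.sum_comm]
    exact Finset.sum_congr rfl fun j _ => (Finset.mul_sum _ _ _).symm
  simp_rw [key, ← Finset.mul_sum, hswap, Finset.mul_sum]
  refine Finset.sum_congr rfl fun i _ => Finset.sum_congr rfl fun j _ => ?_
  simp_rw [← Finset.mul_sum]
  split_ifs with h
  · subst h
    have h0 : ∀ S : Finset ι, (if i ∈ S then (1 : ℝ) else 0) * (if i ∈ S then 0 else 1) = 0 :=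
      fun S => by split_ifs <;> simp
    simp [h0]
  · rw [sum_finset_separating h]
    field_simp

variable {Ω : Type*} [MeasurableSpace Ω] {μ : Measure Ω}

/-- Exponential moments of the off-diagonal part of a quadratic form. -/
lemma expMoment_offDiag_le {c L t : ℝ} {ξ : ι → Ω → ℝ} (hξ : ∀ i, IsSubGaussian μ c (ξ i))
    (hind : iIndepFun ξ μ) (M : Matrix ι ι ℝ)
    (hL : ∀ x : ι → ℝ, ∑ k, (M *ᵥ x) k ^ 2 ≤ L * ∑ i, x i ^ 2)
    (hc : 0 ≤ c) (htL : c ^ 2 * t ^ 2 * L ≤ 1 / 32) :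
    expMoment μ (fun ω => t * ∑ i, ∑ j, (if i = j then 0 else M i j * ξ i ω * ξ j ω)) ≤
      ENNReal.ofReal (Real.exp (16 * c ^ 2 * t ^ 2 * ∑ k, ∑ i, M k i ^ 2)) := by
  have hm : ∀ i, Measurable (ξ i) := fun i => (hξ i).measurable
  have hmask : ∀ (p : Prop) [Decidable p] (i : ι),
      IsSubGaussian μ c (fun ω => if p then ξ i ω else 0) := by
    intro p _ i
    split_ifs
    · exact hξ i
    · have := ((hξ i).const_mul 0).mono (c' := c) (by simpa using hc)
      simpa using this
  have hterm : ∀ S : Finset ι, expMoment μ (fun ω => 4 * t * ∑ i, (if i ∈ S then ξ i ω else 0) *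
      (M *ᵥ fun j => if j ∈ S then 0 else ξ j ω) i) ≤
      ENNReal.ofReal (Real.exp (16 * c ^ 2 * t ^ 2 * ∑ k, ∑ i, M k i ^ 2)) := by
    intro S
    -- The two masked vectors are functions (extension by zero) of the coordinate blocks on `S` and
    -- on `Sᶜ`, which are independent.
    have hind2 : IndepFun (fun ω i => if i ∈ S then ξ i ω else 0)
        (fun ω i => if i ∈ S then 0 else ξ i ω) μ := by
      have h0 := hind.indepFun_finset S Sᶜ disjoint_compl_right hm
      have h1 := h0.comp (φ := fun (y : S → ℝ) (i : ι) => if hi : i ∈ S then y ⟨i, hi⟩ else 0)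
        (ψ := fun (y : (Sᶜ : Finset ι) → ℝ) (i : ι) =>
          if hi : i ∈ S then 0 else y ⟨i, Finset.mem_compl.2 hi⟩)
        (measurable_pi_lambda _ fun i => by split_ifs <;> fun_prop)
        (measurable_pi_lambda _ fun i => by split_ifs <;> fun_prop)
      convert h1 using 1 <;> (funext ω i; by_cases hi : i ∈ S <;> simp [hi])
    have := expMoment_bilinear_le (t := 4 * t) (g := fun i ω => if i ∈ S then ξ i ω else 0)
      (h := fun i ω => if i ∈ S then 0 else ξ i ω) (fun i => hmask _ i)
      (hind.comp (fun i x => if i ∈ S then x else 0) fun i => by split_ifs <;> fun_prop)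
      (fun i => by simpa [ite_not] using hmask (i ∉ S) i)
      (hind.comp (fun i x => if i ∈ S then 0 else x) fun i => by split_ifs <;> fun_prop)
      hind2 M hL hc hc (by nlinarith)
    convert this using 4
    ring
  have hpow : (0 : ℝ) < 2 ^ Fintype.card ι := by positivity
  calc expMoment μ (fun ω => t * ∑ i, ∑ j, (if i = j then 0 else M i j * ξ i ω * ξ j ω))
      ≤ ∫⁻ ω, ∑ S : Finset ι, ENNReal.ofReal ((2 : ℝ) ^ Fintype.card ι)⁻¹ *
          ENNReal.ofReal (Real.exp (4 * t * ∑ i, (if i ∈ S then ξ i ω else 0) *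
            (M *ᵥ fun j => if j ∈ S then 0 else ξ j ω) i)) ∂μ := by
        refine lintegral_mono fun ω => ?_
        simp_rw [← ENNReal.ofReal_mul (inv_pos.2 hpow).le]
        rw [← ENNReal.ofReal_sum_of_nonneg fun _ _ => by positivity]
        refine ENNReal.ofReal_le_ofReal ?_
        rw [offDiag_eq_average M (fun i => ξ i ω), Finset.mul_sum]
        -- Jensen: the off-diagonal form is a uniform average over `S`, so its exponential is at
        -- most the average of the exponentials.
        have := convexOn_exp.map_sum_le (t := (Finset.univ : Finset (Finset ι)))
          (w := fun _ => ((2 : ℝ) ^ Fintype.card ι)⁻¹)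
          (p := fun S => 4 * t * ∑ i, (if i ∈ S then ξ i ω else 0) *
            (M *ᵥ fun j => if j ∈ S then 0 else ξ j ω) i)
          (fun _ _ => by positivity) (by simp) (fun _ _ => Set.mem_univ _)
        simp only [smul_eq_mul] at this
        refine le_trans (le_of_eq ?_) this
        congr 1
        exact Finset.sum_congr rfl fun S _ => by ring
    _ = ∑ S : Finset ι, ENNReal.ofReal ((2 : ℝ) ^ Fintype.card ι)⁻¹ *
          expMoment μ (fun ω => 4 * t * ∑ i, (if i ∈ S then ξ i ω else 0) *
            (M *ᵥ fun j => if j ∈ S then 0 else ξ j ω) i) := by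
        have hmeas : ∀ S : Finset ι, Measurable fun ω => ENNReal.ofReal (Real.exp
            (4 * t * ∑ i, (if i ∈ S then ξ i ω else 0) *
            (M *ᵥ fun j => if j ∈ S then 0 else ξ j ω) i)) := by
          intro S
          have h1 : ∀ i, Measurable fun ω => if i ∈ S then ξ i ω else 0 := fun i => by
            split_ifs <;> fun_prop
          have h2 : ∀ i, Measurable fun ω => if i ∈ S then 0 else ξ i ω := fun i => by
            split_ifs <;> fun_prop
          simp only [Matrix.mulVec, dotProduct]
          fun_prop
        rw [lintegral_finsetSum _ fun S _ => (hmeas S).const_mul _]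
        exact Finset.sum_congr rfl fun S _ => lintegral_const_mul _ (hmeas S)
    _ ≤ ∑ S : Finset ι, ENNReal.ofReal ((2 : ℝ) ^ Fintype.card ι)⁻¹ *
          ENNReal.ofReal (Real.exp (16 * c ^ 2 * t ^ 2 * ∑ k, ∑ i, M k i ^ 2)) :=
        Finset.sum_le_sum fun S _ => by gcongr; exact hterm S
    _ = _ := by
        rw [← Finset.sum_mul, ← ENNReal.ofReal_sum_of_nonneg fun _ _ => by positivity]
        simp

end Decoupling

/-! ### Centered squares -/

section Diagonal

variable {Ω : Type*} [MeasurableSpace Ω] {μ : Measure Ω}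

lemma exp_le_one_add_add_sq_mul_exp_abs (x : ℝ) :
    Real.exp x ≤ 1 + x + x ^ 2 * Real.exp |x| := by
  have h1 : 1 ≤ Real.exp |x| := Real.one_le_exp (abs_nonneg x)
  rcases le_or_gt |x| 1 with h | h
  · have := (abs_le.1 (Real.abs_exp_sub_one_sub_id_le h)).2
    nlinarith [sq_nonneg x]
  · have hx : 1 ≤ x ^ 2 := by rw [← sq_abs]; nlinarith
    rcases le_total 0 x with h0 | h0
    · rw [abs_of_nonneg h0] at *
      nlinarith
    · have := Real.exp_le_one_iff.2 h0
      rw [abs_of_nonpos h0] at *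
      nlinarith

lemma IsSubGaussian.expMoment_sq_le [IsProbabilityMeasure μ] {c θ : ℝ} {X : Ω → ℝ}
    (h : IsSubGaussian μ c X) (hc : 0 ≤ c) (hθ : 0 ≤ θ) (hcθ : c * θ ≤ 1 / 4) :
    expMoment μ (fun ω => θ * X ω ^ 2) ≤ ENNReal.ofReal (Real.exp (2 * c * θ)) := by
  have := expMoment_sq_mulVec_le (μ := μ) (ι := Fin 1) (h := fun _ => X) (L := 1) (fun _ => h)
    iIndepFun.of_subsingleton (1 : Matrix (Fin 1) (Fin 1) ℝ) (by simp) hc hθ (by simpa using hcθ)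
  simpa using this

lemma integrable_exp_of_expMoment_le {X : Ω → ℝ} (hX : Measurable X) {b : ℝ}
    (h : expMoment μ X ≤ ENNReal.ofReal b) : Integrable (fun ω => Real.exp (X ω)) μ :=
  ⟨by fun_prop, by
    rw [hasFiniteIntegral_iff_ofReal (ae_of_all _ fun _ => (Real.exp_pos _).le)]
    exact h.trans_lt ENNReal.ofReal_lt_top⟩

lemma integral_exp_le_of_expMoment_le {X : Ω → ℝ} (hX : Measurable X) {b : ℝ} (hb : 0 ≤ b)
    (h : expMoment μ X ≤ ENNReal.ofReal b) : ∫ ω, Real.exp (X ω) ∂μ ≤ b := by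
  rw [integral_eq_lintegral_of_nonneg_ae (ae_of_all _ fun _ => (Real.exp_pos _).le) (by fun_prop)]
  exact ENNReal.toReal_le_of_le_ofReal hb h

/-- Exponential moments of a centered square of a sub-Gaussian variable. -/
lemma IsSubGaussian.expMoment_centered_sq_le [IsProbabilityMeasure μ] {c s v : ℝ} {X : Ω → ℝ}
    (h : IsSubGaussian μ c X) (hc : 0 < c) (hv : ∫ ω, X ω ^ 2 ∂μ = v) (hs : |s| * (8 * c) ≤ 1) :
    expMoment μ (fun ω => s * (X ω ^ 2 - v)) ≤
      ENNReal.ofReal (Real.exp (1024 * c ^ 2 * s ^ 2)) := by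
  have hX := h.measurable
  -- With this `a`, the moment of `2aX²` sits exactly at the threshold `c · 2a = 1/4` of the
  -- chi-square bound.
  set a : ℝ := 1 / (8 * c) with ha
  have ha0 : 0 < a := by positivity
  have hca : c * (2 * a) = 1 / 4 := by rw [ha]; field_simp; norm_num
  have hsa : |s| ≤ a := by rw [ha, le_div_iff₀ (by positivity)]; exact hs
  have hE := h.expMoment_sq_le hc.le (θ := 2 * a) (by positivity) hca.le
  have he : 2 * c * (2 * a) = 1 / 2 := by linarith
  rw [he] at hE
  have hint : Integrable (fun ω => Real.exp (2 * a * X ω ^ 2)) μ :=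
    integrable_exp_of_expMoment_le (by fun_prop) hE
  have hle : ∫ ω, Real.exp (2 * a * X ω ^ 2) ∂μ ≤ Real.exp (1 / 2) :=
    integral_exp_le_of_expMoment_le (by fun_prop) (Real.exp_pos _).le hE
  have hsq : Integrable (fun ω => X ω ^ 2) μ := by
    refine (hint.const_mul (1 / (2 * a))).mono' (by fun_prop) (ae_of_all _ fun ω => ?_)
    rw [Real.norm_of_nonneg (sq_nonneg _)]
    have := Real.add_one_le_exp (2 * a * X ω ^ 2)
    rw [div_mul_eq_mul_div, le_div_iff₀ (by positivity)]
    linarith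
  have hv0 : 0 ≤ v := hv ▸ integral_nonneg fun _ => sq_nonneg _
  have hexp2 : Real.exp (1 / 2) ≤ 2 := by
    have h1 : Real.exp (1 / 2) ^ 2 = Real.exp 1 := by rw [← Real.exp_nat_mul]; norm_num
    have h2 := Real.exp_one_lt_d9
    nlinarith [Real.exp_pos (1 / 2)]
  have hav : 2 * a * v ≤ 1 := by
    have h1 : ∫ ω, (2 * a * X ω ^ 2 + 1) ∂μ ≤ ∫ ω, Real.exp (2 * a * X ω ^ 2) ∂μ :=
      integral_mono ((hsq.const_mul _).add (integrable_const _)) hint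
        fun ω => Real.add_one_le_exp _
    rw [integral_add (hsq.const_mul _) (integrable_const _), integral_const_mul, hv] at h1
    simp only [integral_const, probReal_univ, smul_eq_mul, mul_one] at h1
    linarith
  -- The linear term integrates to zero, so only an `s²` remainder survives; its constant is `128 ·
  -- 4 · 2 = 1024` after bounding `exp(2av)` by 4 and the moment by 2.
  have hpt : ∀ ω, Real.exp (s * (X ω ^ 2 - v)) ≤ 1 + s * (X ω ^ 2 - v) +
      128 * c ^ 2 * s ^ 2 * Real.exp (2 * a * v) * Real.exp (2 * a * X ω ^ 2) := by
    intro ω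
    refine (exp_le_one_add_add_sq_mul_exp_abs _).trans ?_
    have hD : |X ω ^ 2 - v| ≤ X ω ^ 2 + v :=
      abs_le.2 ⟨by nlinarith [sq_nonneg (X ω)], by linarith⟩
    set y := a * (X ω ^ 2 + v) with hy
    have hy0 : 0 ≤ y := by positivity
    have h1 : |s * (X ω ^ 2 - v)| ≤ y := by
      rw [abs_mul]; exact mul_le_mul hsa hD (abs_nonneg _) ha0.le
    have h2 : (s * (X ω ^ 2 - v)) ^ 2 ≤ 64 * c ^ 2 * s ^ 2 * y ^ 2 := by
      have : (X ω ^ 2 - v) ^ 2 ≤ (X ω ^ 2 + v) ^ 2 :=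
        sq_le_sq' (by nlinarith [sq_nonneg (X ω)]) (by linarith)
      have h3 : 64 * c ^ 2 * s ^ 2 * y ^ 2 = s ^ 2 * (X ω ^ 2 + v) ^ 2 := by
        rw [hy, ha]; field_simp; ring
      rw [h3, mul_pow]
      gcongr
    have h3 : y ^ 2 ≤ 2 * Real.exp y := by
      have := Real.quadratic_le_exp_of_nonneg hy0
      linarith
    have h4 : Real.exp (2 * a * v) * Real.exp (2 * a * X ω ^ 2) = Real.exp y * Real.exp y := by
      rw [← Real.exp_add, ← Real.exp_add]; congr 1; rw [hy]; ring
    have h5 : (s * (X ω ^ 2 - v)) ^ 2 * Real.exp |s * (X ω ^ 2 - v)| ≤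
        (64 * c ^ 2 * s ^ 2 * (2 * Real.exp y)) * Real.exp y := by
      refine mul_le_mul (h2.trans ?_) (Real.exp_le_exp.2 h1) (Real.exp_pos _).le (by positivity)
      gcongr
    rw [mul_assoc _ (Real.exp (2 * a * v)), h4]
    linarith
  have hRint : Integrable (fun ω => 1 + s * (X ω ^ 2 - v) +
      128 * c ^ 2 * s ^ 2 * Real.exp (2 * a * v) * Real.exp (2 * a * X ω ^ 2)) μ :=
    ((integrable_const _).add ((hsq.sub (integrable_const _)).const_mul _)).add (hint.const_mul _)
  calc expMoment μ (fun ω => s * (X ω ^ 2 - v))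
      ≤ ∫⁻ ω, ENNReal.ofReal (1 + s * (X ω ^ 2 - v) +
          128 * c ^ 2 * s ^ 2 * Real.exp (2 * a * v) * Real.exp (2 * a * X ω ^ 2)) ∂μ :=
        lintegral_mono fun ω => ENNReal.ofReal_le_ofReal (hpt ω)
    _ = ENNReal.ofReal (∫ ω, (1 + s * (X ω ^ 2 - v) +
          128 * c ^ 2 * s ^ 2 * Real.exp (2 * a * v) * Real.exp (2 * a * X ω ^ 2)) ∂μ) :=
        (ofReal_integral_eq_lintegral_ofReal hRint
          (ae_of_all _ fun ω => (Real.exp_pos _).le.trans (hpt ω))).symm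
    _ ≤ _ := by
        apply ENNReal.ofReal_le_ofReal
        have hc1 : Integrable (fun ω => s * (X ω ^ 2 - v)) μ :=
          (hsq.sub (integrable_const _)).const_mul _
        have hc2 : Integrable (fun ω => 1 + s * (X ω ^ 2 - v)) μ := (integrable_const _).add hc1
        rw [integral_add hc2 (hint.const_mul _), integral_add (integrable_const _) hc1,
          integral_const_mul, integral_const_mul, integral_sub hsq (integrable_const _), hv]
        simp only [integral_const, probReal_univ, smul_eq_mul, one_mul, mul_one, sub_self, mul_zero,
          add_zero]
        refine le_trans ?_ (Real.add_one_le_exp _)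
        have h6 : Real.exp (2 * a * v) ≤ 4 := by
          have h1 : Real.exp (1 / 2) ^ 2 = Real.exp 1 := by rw [← Real.exp_nat_mul]; norm_num
          have := Real.exp_le_exp.2 hav
          nlinarith [Real.exp_pos (1 / 2)]
        have h7 : Real.exp (2 * a * v) * ∫ ω, Real.exp (2 * a * X ω ^ 2) ∂μ ≤ 4 * 2 :=
          mul_le_mul h6 (hle.trans hexp2) (integral_nonneg fun _ => (Real.exp_pos _).le) (by norm_num)
        have := mul_le_mul_of_nonneg_left h7 (by positivity : 0 ≤ 128 * c ^ 2 * s ^ 2)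
        linarith

/-- Exponential moments of a linear combination of centered squares. -/
lemma expMoment_diag_le {ι : Type*} [Fintype ι] {c t v : ℝ} {ξ : ι → Ω → ℝ}
    (hξ : ∀ i, IsSubGaussian μ c (ξ i)) (hind : iIndepFun ξ μ) (hc : 0 < c)
    (hv : ∀ i, ∫ ω, ξ i ω ^ 2 ∂μ = v) (d : ι → ℝ) (hd : ∀ i, |t * d i| * (8 * c) ≤ 1) :
    expMoment μ (fun ω => t * ∑ i, d i * (ξ i ω ^ 2 - v)) ≤
      ENNReal.ofReal (Real.exp (1024 * c ^ 2 * t ^ 2 * ∑ i, d i ^ 2)) := by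
  have := hind.isProbabilityMeasure
  have hm : ∀ i, Measurable (ξ i) := fun i => (hξ i).measurable
  have := expMoment_sum_le (X := fun i ω => t * d i * (ξ i ω ^ 2 - v)) (fun i => by fun_prop)
    (hind.comp (fun i x => t * d i * (x ^ 2 - v)) (fun i => by fun_prop))
    (fun i => (hξ i).expMoment_centered_sq_le hc (hv i) (hd i))
  convert this using 3
  · rw [Finset.mul_sum]
    exact Finset.sum_congr rfl fun _ _ => by ring
  · rw [Finset.mul_sum]
    exact Finset.sum_congr rfl fun _ _ => by ring

end Diagonal

/-! ### Chernoff bounds and Hanson-Wright -/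

section Tails

variable {Ω : Type*} [MeasurableSpace Ω] {μ : Measure Ω}

lemma measure_lt_le_of_expMoment_le {S : Ω → ℝ} (hS : Measurable S) {l b t : ℝ} (hl : 0 ≤ l)
    (h : expMoment μ (fun ω => l * S ω) ≤ ENNReal.ofReal (Real.exp b)) :
    μ {ω | t < S ω} ≤ ENNReal.ofReal (Real.exp (b - l * t)) := by
  have h1 : μ {ω | t < S ω} ≤
      μ {ω | ENNReal.ofReal (Real.exp (l * t)) ≤ ENNReal.ofReal (Real.exp (l * S ω))} :=
    measure_mono fun ω hω => ENNReal.ofReal_le_ofReal (Real.exp_le_exp.2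
      (mul_le_mul_of_nonneg_left (le_of_lt hω) hl))
  have h2 := meas_ge_le_lintegral_div (μ := μ)
    (f := fun ω => ENNReal.ofReal (Real.exp (l * S ω))) (by fun_prop)
    (ε := ENNReal.ofReal (Real.exp (l * t)))
    (ENNReal.ofReal_pos.2 (Real.exp_pos _)).ne' ENNReal.ofReal_ne_top
  refine (h1.trans h2).trans ((ENNReal.div_le_div_right h _).trans_eq ?_)
  rw [← ENNReal.ofReal_div_of_pos (Real.exp_pos _), Real.exp_sub]

lemma measure_abs_lt_le_of_expMoment_le {S : Ω → ℝ} (hS : Measurable S) {l b t : ℝ} (hl : 0 ≤ l)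
    (h : expMoment μ (fun ω => l * S ω) ≤ ENNReal.ofReal (Real.exp b))
    (h' : expMoment μ (fun ω => -l * S ω) ≤ ENNReal.ofReal (Real.exp b)) :
    μ {ω | t < |S ω|} ≤ 2 * ENNReal.ofReal (Real.exp (b - l * t)) := by
  have hsub : {ω | t < |S ω|} ⊆ {ω | t < S ω} ∪ {ω | t < -S ω} := fun ω hω => by
    simpa [lt_abs] using hω
  rw [two_mul]
  refine (measure_mono hsub).trans ((measure_union_le _ _).trans (add_le_add
    (measure_lt_le_of_expMoment_le hS hl h)
    (measure_lt_le_of_expMoment_le hS.neg hl ?_)))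
  simpa using h'

/-- A Hanson-Wright inequality in the sub-Gaussian regime of deviations. -/
lemma measure_quadratic_deviation_le {ι : Type*} [Fintype ι] [DecidableEq ι] {c L F T v : ℝ}
    {ξ : ι → Ω → ℝ} (hξ : ∀ i, IsSubGaussian μ c (ξ i)) (hind : iIndepFun ξ μ) (hc : 0 < c)
    (hv : ∀ i, ∫ ω, ξ i ω ^ 2 ∂μ = v) (M : Matrix ι ι ℝ)
    (hL : ∀ x : ι → ℝ, ∑ k, (M *ᵥ x) k ^ 2 ≤ L * ∑ i, x i ^ 2)
    (hF : ∑ k, ∑ i, M k i ^ 2 = F ^ 2) (hF0 : 0 < F) (hT : 0 ≤ T) (hTL : T * L ≤ F ^ 2) :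
    μ {ω | 200 * c * √T * F < |(∑ i, ξ i ω * (M *ᵥ fun j => ξ j ω) i) - v * M.trace|} ≤
      4 * ENNReal.ofReal (Real.exp (-(4 * T))) := by
  have hm : ∀ i, Measurable (ξ i) := fun i => (hξ i).measurable
  have hT2 : √T ^ 2 = T := Real.sq_sqrt hT
  set Off : Ω → ℝ := fun ω => ∑ i, ∑ j, (if i = j then 0 else M i j * ξ i ω * ξ j ω) with hOff
  set Diag : Ω → ℝ := fun ω => ∑ i, M i i * (ξ i ω ^ 2 - v) with hDiag
  have hsplit : ∀ ω, (∑ i, ξ i ω * (M *ᵥ fun j => ξ j ω) i) - v * M.trace = Off ω + Diag ω := by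
    intro ω
    simp only [hOff, hDiag, Matrix.trace, Matrix.diag, Matrix.mulVec, dotProduct]
    rw [Finset.mul_sum, ← Finset.sum_sub_distrib, ← Finset.sum_add_distrib]
    refine Finset.sum_congr rfl fun i _ => ?_
    have h1 : ∑ j, (if i = j then 0 else M i j * ξ i ω * ξ j ω) =
        ∑ j, (M i j * ξ i ω * ξ j ω - if i = j then M i j * ξ i ω * ξ j ω else 0) :=
      Finset.sum_congr rfl fun j _ => by split_ifs <;> simp
    rw [h1, Finset.sum_sub_distrib, Finset.sum_ite_eq, if_pos (Finset.mem_univ _), Finset.mul_sum,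
      Finset.sum_congr rfl fun j _ => (by ring : ξ i ω * (M i j * ξ j ω) = M i j * ξ i ω * ξ j ω)]
    ring
  have hOffm : Measurable Off := by
    refine Finset.measurable_fun_sum _ fun i _ => Finset.measurable_fun_sum _ fun j _ => ?_
    split_ifs <;> fun_prop
  have hDiagm : Measurable Diag := by fun_prop
  have hdiagL : ∀ i, M i i ^ 2 ≤ L := by
    intro i
    have h1 := hL (Pi.single i 1)
    have h2 : ∑ j, (Pi.single i 1 : ι → ℝ) j ^ 2 = 1 := by simp [Pi.single_apply]
    rw [h2, mul_one] at h1
    refine le_trans ?_ h1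
    have := Finset.single_le_sum (f := fun k => (M *ᵥ Pi.single i 1) k ^ 2)
      (fun k _ => sq_nonneg _) (Finset.mem_univ i)
    simpa using this
  have hTLF : T * L / F ^ 2 ≤ 1 := (div_le_one (by positivity)).2 hTL
  have hoff : μ {ω | 40 * c * √T * F < |Off ω|} ≤ 2 * ENNReal.ofReal (Real.exp (-(4 * T))) := by
    -- This Chernoff parameter gives exponent `T/4 - 5T ≤ -4T`; the hypothesis `T L ≤ F²` keeps it
    -- in the admissible range.
    set l : ℝ := √T / (8 * c * F) with hl
    have hl2 : l ^ 2 = T / (64 * c ^ 2 * F ^ 2) := by rw [hl, div_pow, hT2]; ring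
    have hcond : c ^ 2 * l ^ 2 * L ≤ 1 / 32 := by
      have : c ^ 2 * l ^ 2 * L = T * L / F ^ 2 / 64 := by rw [hl2]; field_simp
      rw [this]; linarith
    have h1 := expMoment_offDiag_le hξ hind M hL hc.le hcond
    have h2 := expMoment_offDiag_le (t := -l) hξ hind M hL hc.le (by rwa [neg_sq])
    rw [neg_sq] at h2
    refine (measure_abs_lt_le_of_expMoment_le hOffm (by positivity) h1 h2).trans ?_
    gcongr
    rw [hF, hl2]
    have h3 : 16 * c ^ 2 * (T / (64 * c ^ 2 * F ^ 2)) * F ^ 2 = T / 4 := by field_simp; ring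
    have h4 : l * (40 * c * √T * F) = 5 * T := by
      rw [hl]; nth_rewrite 3 [← hT2]; field_simp; ring
    rw [h3, h4]
    linarith
  have hdiag : μ {ω | 160 * c * √T * F < |Diag ω|} ≤ 2 * ENNReal.ofReal (Real.exp (-(4 * T))) := by
    -- Here the exponent is at most `T - 5T = -4T`. Admissibility uses `M_ii² ≤ L`.
    set l : ℝ := √T / (32 * c * F) with hl
    have hl2 : l ^ 2 = T / (1024 * c ^ 2 * F ^ 2) := by rw [hl, div_pow, hT2]; ring
    have hcond : ∀ i, |l * M i i| * (8 * c) ≤ 1 := by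
      intro i
      have : (|l * M i i| * (8 * c)) ^ 2 ≤ 1 := by
        rw [mul_pow, sq_abs, mul_pow, hl2]
        have h1 : T / (1024 * c ^ 2 * F ^ 2) * M i i ^ 2 * (8 * c) ^ 2 =
          T * M i i ^ 2 / F ^ 2 / 16 := by field_simp; ring
        have h2 : T * M i i ^ 2 / F ^ 2 ≤ T * L / F ^ 2 := by gcongr; exact hdiagL i
        rw [h1]; linarith
      exact (sq_le_one_iff₀ (by positivity)).1 this
    have h1 := expMoment_diag_le hξ hind hc hv (fun i => M i i) hcond
    have h2 := expMoment_diag_le (t := -l) hξ hind hc hv (fun i => M i i)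
      (by simpa only [neg_mul, abs_neg] using hcond)
    rw [neg_sq] at h2
    refine (measure_abs_lt_le_of_expMoment_le hDiagm (by positivity) h1 h2).trans ?_
    gcongr
    have hdF : ∑ i, M i i ^ 2 ≤ F ^ 2 := by
      rw [← hF]
      exact Finset.sum_le_sum fun i _ => Finset.single_le_sum (f := fun j => M i j ^ 2)
        (fun _ _ => sq_nonneg _) (Finset.mem_univ i)
    have h3 : 1024 * c ^ 2 * l ^ 2 * ∑ i, M i i ^ 2 ≤ 1024 * c ^ 2 * l ^ 2 * F ^ 2 := by gcongr
    have h3' : 1024 * c ^ 2 * l ^ 2 * F ^ 2 = T := by rw [hl2]; field_simp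
    have h4 : l * (160 * c * √T * F) = 5 * T := by
      rw [hl]; nth_rewrite 3 [← hT2]; field_simp; ring
    rw [h4]
    linarith
  have hsub : {ω | 200 * c * √T * F < |(∑ i, ξ i ω * (M *ᵥ fun j => ξ j ω) i) - v * M.trace|} ⊆
      {ω | 40 * c * √T * F < |Off ω|} ∪ {ω | 160 * c * √T * F < |Diag ω|} := by
    intro ω hω
    by_contra hcon
    simp only [Set.mem_union, Set.mem_ofPred_eq, not_or, not_lt] at hcon hω
    rw [hsplit] at hω
    have := abs_add_le (Off ω) (Diag ω)
    linarith [hcon.1, hcon.2]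
  refine (measure_mono hsub).trans ((measure_union_le _ _).trans
    ((add_le_add hoff hdiag).trans_eq ?_))
  ring

/-- Deviations of a bilinear form in two independent sub-Gaussian vectors. -/
lemma measure_bilinear_deviation_le {ι κ : Type*} [Fintype ι] [Fintype κ] {c d e L F T : ℝ}
    {g : κ → Ω → ℝ} {h : ι → Ω → ℝ} (hg : ∀ k, IsSubGaussian μ d (g k)) (hgi : iIndepFun g μ)
    (hh : ∀ i, IsSubGaussian μ c (h i)) (hhi : iIndepFun h μ)
    (hgh : IndepFun (fun ω k => g k ω) (fun ω i => h i ω) μ)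
    (P : Matrix κ ι ℝ) (hL : ∀ x : ι → ℝ, ∑ k, (P *ᵥ x) k ^ 2 ≤ L * ∑ i, x i ^ 2)
    (hc : 0 ≤ c) (hd : 0 ≤ d) (he : 0 < e) (hcd : c * d = e ^ 2)
    (hF : ∑ k, ∑ i, P k i ^ 2 = F ^ 2) (hF0 : 0 < F) (hT : 0 ≤ T) (hTL : T * L ≤ F ^ 2) :
    μ {ω | 9 * e * √T * F < |∑ k, g k ω * (P *ᵥ fun i => h i ω) k|} ≤
      2 * ENNReal.ofReal (Real.exp (-(4 * T))) := by
  have hgm : ∀ i, Measurable (g i) := fun i => (hg i).measurable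
  have hhm : ∀ i, Measurable (h i) := fun i => (hh i).measurable
  have hT2 : √T ^ 2 = T := Real.sq_sqrt hT
  have hTLF : T * L / F ^ 2 ≤ 1 := (div_le_one (by positivity)).2 hTL
  -- The exponent becomes `T/4 - 9T/2 ≤ -4T`.
  set l : ℝ := √T / (2 * e * F) with hl
  have hl2 : l ^ 2 = T / (4 * e ^ 2 * F ^ 2) := by rw [hl, div_pow, hT2]; ring
  have hcond : c * d * l ^ 2 * L ≤ 1 / 2 := by
    have : c * d * l ^ 2 * L = T * L / F ^ 2 / 4 := by rw [hl2, hcd]; field_simp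
    rw [this]; linarith
  have h1 := expMoment_bilinear_le hg hgi hh hhi hgh P hL hc hd hcond
  have h2 := expMoment_bilinear_le (t := -l) hg hgi hh hhi hgh P hL hc hd (by rwa [neg_sq])
  rw [neg_sq] at h2
  have hmeas : Measurable fun ω => ∑ k, g k ω * (P *ᵥ fun i => h i ω) k := by
    simp only [Matrix.mulVec, dotProduct]
    fun_prop
  refine (measure_abs_lt_le_of_expMoment_le hmeas (by positivity) h1 h2).trans ?_
  gcongr
  have h3 : c * d * l ^ 2 * F ^ 2 = T / 4 := by rw [hl2, hcd]; field_simp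
  have h4 : l * (9 * e * √T * F) = 9 / 2 * T := by
    rw [hl]; nth_rewrite 3 [← hT2]; field_simp
  rw [hF, h3, h4]
  linarith

end Tails

/-! ### From the `ψ₂`-norm to sub-Gaussian moments -/

section PsiTwo

variable {Ω : Type*} [MeasurableSpace Ω] {μ : Measure Ω}

lemma expMoment_le_two_of_psiTwoNorm_lt {Y : Ω → ℝ} {t : ℝ}
    (h : psiTwoNorm μ Y < ENNReal.ofReal t) :
    expMoment μ (fun ω => Y ω ^ 2 / t ^ 2) ≤ ENNReal.ofReal 2 := by
  simp only [psiTwoNorm, iInf_lt_iff] at h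
  obtain ⟨s, hs0, hs, hst⟩ := h
  have hst' : s < t := (ENNReal.ofReal_lt_ofReal_iff_of_nonneg hs0.le).1 hst
  refine (expMoment_mono fun ω => ?_).trans (hs.trans_eq (by simp))
  gcongr

/-- The linear term has mean zero for a centered variable, which leaves only a moment of the square.
-/
lemma exp_le_add_exp_sq (x : ℝ) : Real.exp x ≤ x + Real.exp (x ^ 2) := by
  have h1 := Real.add_one_le_exp (x ^ 2)
  rcases le_or_gt |x| 1 with h | h
  · have := (abs_le.1 (Real.abs_exp_sub_one_sub_id_le h)).2
    linarith
  · rcases lt_abs.1 h with h | h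
    · have := Real.exp_le_exp.2 (by nlinarith : x ≤ x ^ 2)
      linarith
    · have := Real.exp_le_one_iff.2 (by linarith : x ≤ 0)
      nlinarith

lemma exp_mul_le_one_add {p y : ℝ} (h0 : 0 ≤ p) (h1 : p ≤ 1) :
    Real.exp (p * y) ≤ 1 + p * (Real.exp y - 1) := by
  have := convexOn_exp.2 (Set.mem_univ 0) (Set.mem_univ y) (sub_nonneg.2 h1) h0 (by ring)
  simp only [smul_eq_mul, mul_zero, zero_add, Real.exp_zero, mul_one] at this
  linarith

lemma expMoment_le_of_le {X f : Ω → ℝ} (hf : Integrable f μ) (h : ∀ ω, Real.exp (X ω) ≤ f ω)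
    {b : ℝ} (hb : ∫ ω, f ω ∂μ ≤ b) : expMoment μ X ≤ ENNReal.ofReal b :=
  calc expMoment μ X ≤ ∫⁻ ω, ENNReal.ofReal (f ω) ∂μ :=
        lintegral_mono fun ω => ENNReal.ofReal_le_ofReal (h ω)
    _ = ENNReal.ofReal (∫ ω, f ω ∂μ) := (ofReal_integral_eq_lintegral_ofReal hf
        (ae_of_all _ fun ω => (Real.exp_pos _).le.trans (h ω))).symm
    _ ≤ _ := ENNReal.ofReal_le_ofReal hb

lemma integral_sq_eq_one {Y : Ω → ℝ} (hY : Measurable Y) (h0 : ∫ ω, Y ω ∂μ = 0)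
    (h1 : variance Y μ = 1) : ∫ ω, Y ω ^ 2 ∂μ = 1 := by
  rw [← h1, variance_eq_integral hY.aemeasurable, h0]
  simp

variable [IsProbabilityMeasure μ]

/-- A centered variable with finite `ψ₂`-norm is sub-Gaussian. -/
lemma isSubGaussian_of_expMoment_sq_le {Y : Ω → ℝ} (hY : Measurable Y) (h0 : ∫ ω, Y ω ∂μ = 0)
    {q : ℝ} (hq : 0 < q) (h : expMoment μ (fun ω => Y ω ^ 2 / q) ≤ ENNReal.ofReal 2) :
    IsSubGaussian μ (2 * q) Y := by
  refine ⟨hY, fun s => ?_⟩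
  have hint : Integrable (fun ω => Real.exp (Y ω ^ 2 / q)) μ :=
    integrable_exp_of_expMoment_le (by fun_prop) h
  have hle : ∫ ω, Real.exp (Y ω ^ 2 / q) ∂μ ≤ 2 :=
    integral_exp_le_of_expMoment_le (by fun_prop) zero_le_two h
  have hYint : Integrable Y μ := by
    refine (hint.const_mul (1 + q)).mono' hY.aestronglyMeasurable (ae_of_all _ fun ω => ?_)
    rw [Real.norm_eq_abs]
    have h1 := Real.add_one_le_exp (Y ω ^ 2 / q)
    have h2 : (1 + q) * (Y ω ^ 2 / q + 1) = Y ω ^ 2 + 1 + Y ω ^ 2 / q + q := by field_simp; ring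
    have h3 : 0 ≤ Y ω ^ 2 / q := by positivity
    have h4 : |Y ω| ≤ Y ω ^ 2 + 1 := by rw [← sq_abs]; nlinarith [sq_nonneg (|Y ω| - 1)]
    nlinarith
  -- For small `s`, centering and convexity give `1 + s²q`. For large `s`, centering is unnecessary:
  -- Young's inequality splits `sY` and the factor `3/2` is absorbed by `exp(s²q/2)`.
  rcases le_or_gt (s ^ 2 * q) 1 with hs | hs
  · refine expMoment_le_of_le
      (f := fun ω => s * Y ω + (1 + s ^ 2 * q * (Real.exp (Y ω ^ 2 / q) - 1)))
      ((hYint.const_mul _).add ((integrable_const _).add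
        ((hint.sub (integrable_const _)).const_mul _))) (fun ω => ?_) ?_
    · refine (exp_le_add_exp_sq _).trans ?_
      have := exp_mul_le_one_add (y := Y ω ^ 2 / q) (by positivity) hs
      have e : s ^ 2 * q * (Y ω ^ 2 / q) = (s * Y ω) ^ 2 := by field_simp
      rw [e] at this
      linarith
    · have i1 : Integrable (fun ω => s ^ 2 * q * (Real.exp (Y ω ^ 2 / q) - 1)) μ :=
        (hint.sub (integrable_const _)).const_mul _
      have i2 : Integrable (fun ω => 1 + s ^ 2 * q * (Real.exp (Y ω ^ 2 / q) - 1)) μ :=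
        (integrable_const _).add i1
      rw [integral_add (hYint.const_mul _) i2, integral_add (integrable_const _) i1,
        integral_const_mul, integral_const_mul, integral_sub hint (integrable_const _), h0]
      simp only [integral_const, probReal_univ, smul_eq_mul, mul_zero, one_mul, zero_add]
      have h1 : s ^ 2 * q * (∫ ω, Real.exp (Y ω ^ 2 / q) ∂μ - 1) ≤ s ^ 2 * q * 1 := by
        gcongr; linarith
      have h2 := Real.add_one_le_exp (2 * q * s ^ 2 / 2)
      linarith
  · refine expMoment_le_of_le
      (f := fun ω => Real.exp (s ^ 2 * q / 2) * (1 / 2 + 1 / 2 * Real.exp (Y ω ^ 2 / q)))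
      (((integrable_const _).add (hint.const_mul _)).const_mul _) (fun ω => ?_) ?_
    · have h1 : s * Y ω ≤ s ^ 2 * q / 2 + 1 / 2 * (Y ω ^ 2 / q) := by
        have h2 : s ^ 2 * q / 2 + 1 / 2 * (Y ω ^ 2 / q) - s * Y ω = (s * q - Y ω) ^ 2 / (2 * q) := by
          field_simp; ring
        have h3 : 0 ≤ (s * q - Y ω) ^ 2 / (2 * q) := by positivity
        linarith
      refine (Real.exp_le_exp.2 h1).trans ?_
      rw [Real.exp_add]
      gcongr
      have := exp_mul_le_one_add (p := 1 / 2) (y := Y ω ^ 2 / q) (by norm_num) (by norm_num)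
      linarith
    · rw [integral_const_mul, integral_add (integrable_const _) (hint.const_mul _),
        integral_const_mul]
      simp only [integral_const, probReal_univ, smul_eq_mul, one_mul]
      have h1 : 1 / 2 + 1 / 2 * ∫ ω, Real.exp (Y ω ^ 2 / q) ∂μ ≤ Real.exp (s ^ 2 * q / 2) := by
        have := Real.add_one_le_exp (s ^ 2 * q / 2)
        linarith
      calc _ ≤ Real.exp (s ^ 2 * q / 2) * Real.exp (s ^ 2 * q / 2) := by gcongr
        _ = _ := by rw [← Real.exp_add]; congr 1; ring

/-- From `1 + x ≤ exp x`, an admissible `t` satisfies `1 + 1/t² ≤ 2`. This is what makes `K`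
positive in the main bound. -/
lemma one_le_of_psiTwoNorm_le {Y : Ω → ℝ} (hY : Measurable Y) {K : ℝ}
    (h2 : ∫ ω, Y ω ^ 2 ∂μ = 1) (h : psiTwoNorm μ Y ≤ ENNReal.ofReal K) : 1 ≤ K := by
  -- A non-integrable function has integral `0` by convention, so the value `1` forces
  -- integrability.
  have hsq : Integrable (fun ω => Y ω ^ 2) μ := by
    by_contra hcon
    rw [integral_undef hcon] at h2
    exact zero_ne_one h2
  have key : ∀ t, max K 0 < t → 1 ≤ t := by
    intro t ht
    have ht0 : 0 < t := (le_max_right _ _).trans_lt ht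
    have hE := expMoment_le_two_of_psiTwoNorm_lt
      (h.trans_lt ((ENNReal.ofReal_lt_ofReal_iff ht0).2 ((le_max_left _ _).trans_lt ht)))
    have hint : Integrable (fun ω => Real.exp (Y ω ^ 2 / t ^ 2)) μ :=
      integrable_exp_of_expMoment_le (by fun_prop) hE
    have h3 : ∫ ω, (Y ω ^ 2 / t ^ 2 + 1) ∂μ ≤ ∫ ω, Real.exp (Y ω ^ 2 / t ^ 2) ∂μ :=
      integral_mono ((hsq.div_const _).add (integrable_const _)) hint
        fun ω => Real.add_one_le_exp _
    rw [integral_add (hsq.div_const _) (integrable_const _), integral_div, h2] at h3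
    simp only [integral_const, probReal_univ, smul_eq_mul, mul_one] at h3
    have h4 := integral_exp_le_of_expMoment_le (by fun_prop) zero_le_two hE
    have h5 : 1 / t ^ 2 ≤ 1 := by linarith
    rw [div_le_one (by positivity)] at h5
    nlinarith
  have h3 : 1 ≤ max K 0 := le_of_forall_gt_imp_ge_of_dense key
  rcases le_max_iff.1 h3 with h | h
  · exact h
  · linarith

lemma isSubGaussian_of_psiTwoNorm_le {Y : Ω → ℝ} (hY : Measurable Y) (h0 : ∫ ω, Y ω ∂μ = 0)
    {K : ℝ} (hK : 0 < K) (h : psiTwoNorm μ Y ≤ ENNReal.ofReal K) :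
    IsSubGaussian μ (8 * K ^ 2) Y := by
  have hE := expMoment_le_two_of_psiTwoNorm_lt (t := 2 * K)
    (h.trans_lt ((ENNReal.ofReal_lt_ofReal_iff (by positivity)).2 (by linarith)))
  -- Doubling `K` avoids deciding whether the infimum is attained; with `q = 4K²` the proxy `2q` is
  -- `8K²`.
  have := isSubGaussian_of_expMoment_sq_le hY h0 (by positivity) hE
  exact this.mono (by nlinarith)

end PsiTwo

/-! ### Independence of rows and second moments -/

section Rows

variable {Ω : Type*} [MeasurableSpace Ω] {μ : Measure Ω}

/-- The joint law is a product over pairs; currying turns it into the product over rows of the row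
laws. -/
lemma iIndepFun_rows {n m : ℕ} {X : Fin n × Fin m → Ω → ℝ} (hX : ∀ p, Measurable (X p))
    (h : iIndepFun X μ) : iIndepFun (fun k ω (j : Fin m) => X (k, j) ω) μ := by
  have := h.isProbabilityMeasure
  have hlaw : ∀ (k : Fin n) (j : Fin m), IsProbabilityMeasure (μ.map (X (k, j))) :=
    fun k j => Measure.isProbabilityMeasure_map (hX _).aemeasurable
  have h1 : iIndepFun (fun (p : (_ : Fin n) × Fin m) ω => X (p.1, p.2) ω) μ :=
    h.precomp (Equiv.sigmaEquivProd (Fin n) (Fin m)).injective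
  have h2 : ∀ k, iIndepFun (fun j ω => X (k, j) ω) μ := fun k =>
    h.precomp (g := fun j : Fin m => (k, j)) fun a b hab => by simpa using hab
  rw [iIndepFun_iff_map_fun_eq_infinitePi_map (by fun_prop)] at h1 ⊢
  simp_rw [fun k => (iIndepFun_iff_map_fun_eq_infinitePi_map (by fun_prop)).1 (h2 k)]
  rw [← Measure.infinitePi_map_piCurry (fun k j => μ.map (X (k, j))), ← h1,
    Measure.map_map (by fun_prop) (by fun_prop)]
  rfl

lemma integral_sq_linearCombination {ι : Type*} [Fintype ι] {X : ι → Ω → ℝ}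
    (hX : ∀ i, Measurable (X i)) (hind : iIndepFun X μ) (h0 : ∀ i, ∫ ω, X i ω ∂μ = 0)
    (h2 : ∀ i, ∫ ω, X i ω ^ 2 ∂μ = 1) (a : ι → ℝ) :
    ∫ ω, (∑ i, a i * X i ω) ^ 2 ∂μ = ∑ i, a i ^ 2 := by
  classical
  have := hind.isProbabilityMeasure
  have hsq : ∀ i, Integrable (fun ω => X i ω ^ 2) μ := fun i => by
    by_contra hcon
    have := h2 i
    rw [integral_undef hcon] at this
    exact zero_ne_one this
  have hL2 : ∀ i, MemLp (X i) 2 μ := fun i =>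
    (memLp_two_iff_integrable_sq (hX i).aestronglyMeasurable).2 (hsq i)
  have hprod : ∀ i j, Integrable (fun ω => X i ω * X j ω) μ := fun i j =>
    (hL2 i).integrable_mul (hL2 j)
  have hE : ∀ i j, ∫ ω, X i ω * X j ω ∂μ = if i = j then 1 else 0 := by
    intro i j
    split_ifs with hij
    · subst hij
      simp_rw [← sq, h2]
    · have := (hind.indepFun hij).integral_fun_mul_eq_mul_integral
        (hX i).aestronglyMeasurable (hX j).aestronglyMeasurable
      rw [this, h0, zero_mul]
  have hexp : ∀ ω, (∑ i, a i * X i ω) ^ 2 = ∑ i, ∑ j, a i * a j * (X i ω * X j ω) := by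
    intro ω
    rw [sq, Finset.sum_mul_sum]
    exact Finset.sum_congr rfl fun i _ => Finset.sum_congr rfl fun j _ => by ring
  simp_rw [hexp]
  rw [integral_finsetSum _ fun i _ => integrable_finsetSum _ fun j _ => (hprod i j).const_mul _]
  refine Finset.sum_congr rfl fun i _ => ?_
  rw [integral_finsetSum _ fun j _ => (hprod i j).const_mul _]
  simp_rw [integral_const_mul, hE]
  simp [sq]

end Rows

/-! ### Matrix norm inequalities and square roots -/

section Norms

variable {p : ℕ}

lemma opNorm_nonneg (M : Matrix (Fin p) (Fin p) ℝ) : 0 ≤ opNorm M := norm_nonneg _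

lemma sum_sq_mulVec_le_opNorm (M : Matrix (Fin p) (Fin p) ℝ) (x : Fin p → ℝ) :
    ∑ k, (M *ᵥ x) k ^ 2 ≤ opNorm M ^ 2 * ∑ i, x i ^ 2 := by
  have h := (Matrix.toEuclideanCLM (n := Fin p) (𝕜 := ℝ) M).le_opNorm (WithLp.toLp 2 x)
  have h2 := pow_le_pow_left₀ (norm_nonneg _) h 2
  rw [mul_pow, EuclideanSpace.norm_sq_eq, EuclideanSpace.norm_sq_eq] at h2
  simpa [opNorm] using h2

lemma dotProduct_mulVec_le_opNorm (M : Matrix (Fin p) (Fin p) ℝ) (x : Fin p → ℝ) :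
    x ⬝ᵥ (M *ᵥ x) ≤ opNorm M * ∑ i, x i ^ 2 := by
  have h0 : 0 ≤ ∑ i, x i ^ 2 := Finset.sum_nonneg fun _ _ => sq_nonneg _
  refine (le_abs_self _).trans (abs_le_of_sq_le_sq ?_ (mul_nonneg (opNorm_nonneg M) h0))
  calc (x ⬝ᵥ (M *ᵥ x)) ^ 2 ≤ (∑ i, x i ^ 2) * ∑ i, (M *ᵥ x) i ^ 2 :=
        Finset.sum_mul_sq_le_sq_mul_sq _ _ _
    _ ≤ (∑ i, x i ^ 2) * (opNorm M ^ 2 * ∑ i, x i ^ 2) :=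
        mul_le_mul_of_nonneg_left (sum_sq_mulVec_le_opNorm M x) h0
    _ = _ := by ring

lemma frobNorm_nonneg {q : ℕ} (M : Matrix (Fin p) (Fin q) ℝ) : 0 ≤ frobNorm M := Real.sqrt_nonneg _

lemma frobNorm_sq {q : ℕ} (M : Matrix (Fin p) (Fin q) ℝ) :
    frobNorm M ^ 2 = ∑ i, ∑ j, M i j ^ 2 :=
  Real.sq_sqrt (Finset.sum_nonneg fun _ _ => Finset.sum_nonneg fun _ _ => sq_nonneg _)

lemma frobNorm_sq_le_mul_opNorm_sq (M : Matrix (Fin p) (Fin p) ℝ) :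
    frobNorm M ^ 2 ≤ p * opNorm M ^ 2 := by
  rw [frobNorm_sq, Finset.sum_comm]
  calc ∑ j, ∑ i, M i j ^ 2 ≤ ∑ _j : Fin p, opNorm M ^ 2 := Finset.sum_le_sum fun j _ => by
        have := sum_sq_mulVec_le_opNorm M (Pi.single j 1)
        simpa [Pi.single_apply] using this
    _ = _ := by simp

lemma apply_le_diagMax (M : Matrix (Fin p) (Fin p) ℝ) (i : Fin p) : M i i ≤ diagMax M :=
  le_ciSup (f := fun i => M i i) (Set.finite_range _).bddAbove i

lemma apply_self_le_opNorm (M : Matrix (Fin p) (Fin p) ℝ) (i : Fin p) : M i i ≤ opNorm M := by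
  have := dotProduct_mulVec_le_opNorm M (Pi.single i 1)
  simpa [Pi.single_apply] using this

lemma trace_le_mul_opNorm (M : Matrix (Fin p) (Fin p) ℝ) : M.trace ≤ p * opNorm M := by
  refine (Finset.sum_le_sum fun i _ => apply_self_le_opNorm M i).trans_eq ?_
  simp

lemma trace_le_mul_diagMax (M : Matrix (Fin p) (Fin p) ℝ) : M.trace ≤ p * diagMax M := by
  refine (Finset.sum_le_sum fun i _ => apply_le_diagMax M i).trans_eq ?_
  simp

lemma sqrt_mul_sqrt_of_posSemidef {M : Matrix (Fin p) (Fin p) ℝ} (hM : M.PosSemidef) :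
    CFC.sqrt M * CFC.sqrt M = M :=
  CFC.sqrt_mul_sqrt_self M hM.nonneg

lemma transpose_sqrt (M : Matrix (Fin p) (Fin p) ℝ) : (CFC.sqrt M)ᵀ = CFC.sqrt M := by
  have := (Matrix.nonneg_iff_posSemidef.1 (CFC.sqrt_nonneg M)).isHermitian
  rwa [Matrix.IsHermitian, Matrix.conjTranspose_eq_transpose_of_trivial] at this

lemma sum_sq_sqrt_mulVec {M : Matrix (Fin p) (Fin p) ℝ} (hM : M.PosSemidef) (x : Fin p → ℝ) :
    ∑ k, (CFC.sqrt M *ᵥ x) k ^ 2 = x ⬝ᵥ (M *ᵥ x) := by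
  conv_rhs => rw [← sqrt_mul_sqrt_of_posSemidef hM, ← Matrix.mulVec_mulVec,
    Matrix.dotProduct_mulVec, ← Matrix.mulVec_transpose, transpose_sqrt]
  simp [dotProduct, sq]

lemma sum_sq_sqrt_col {M : Matrix (Fin p) (Fin p) ℝ} (hM : M.PosSemidef) (i : Fin p) :
    ∑ k, CFC.sqrt M k i ^ 2 = M i i := by
  have := sum_sq_sqrt_mulVec hM (Pi.single i 1)
  simpa using this

lemma sum_sq_sqrt {M : Matrix (Fin p) (Fin p) ℝ} (hM : M.PosSemidef) :
    ∑ k, ∑ i, CFC.sqrt M k i ^ 2 = M.trace := by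
  rw [Finset.sum_comm]
  exact Finset.sum_congr rfl fun i _ => sum_sq_sqrt_col hM i

lemma apply_self_nonneg {M : Matrix (Fin p) (Fin p) ℝ} (hM : M.PosSemidef) (i : Fin p) :
    0 ≤ M i i := by
  rw [← sum_sq_sqrt_col hM]
  exact Finset.sum_nonneg fun _ _ => sq_nonneg _

lemma trace_nonneg {M : Matrix (Fin p) (Fin p) ℝ} (hM : M.PosSemidef) : 0 ≤ M.trace :=
  Finset.sum_nonneg fun i _ => apply_self_nonneg hM i

/-- The `j`-th column of `M` is `M^{1/2}` applied to the `j`-th column of `M^{1/2}`, and the squared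
columns of `M^{1/2}` sum to the trace. -/
lemma frobNorm_sq_le_opNorm_mul_trace {M : Matrix (Fin p) (Fin p) ℝ} (hM : M.PosSemidef) :
    frobNorm M ^ 2 ≤ opNorm M * M.trace := by
  have htr : ∑ j, ∑ k, CFC.sqrt M k j ^ 2 = M.trace := by
    rw [Finset.sum_comm, sum_sq_sqrt hM]
  rw [frobNorm_sq, ← htr, Finset.sum_comm, Finset.mul_sum]
  refine Finset.sum_le_sum fun j _ => ?_
  have h := sum_sq_sqrt_mulVec hM (fun i => CFC.sqrt M i j)
  have h2 := dotProduct_mulVec_le_opNorm M (fun i => CFC.sqrt M i j)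
  rw [← h] at h2
  refine le_trans (le_of_eq ?_) h2
  refine Finset.sum_congr rfl fun k _ => ?_
  conv_lhs => rw [← sqrt_mul_sqrt_of_posSemidef hM]
  rfl

/-- `M` is the Gram matrix of the columns of `M^{1/2}`, so Cauchy-Schwarz gives `M_ij² ≤ M_ii M_jj`.
-/
lemma frobNorm_le_trace {M : Matrix (Fin p) (Fin p) ℝ} (hM : M.PosSemidef) :
    frobNorm M ≤ M.trace := by
  refine (le_abs_self _).trans (abs_le_of_sq_le_sq ?_ (trace_nonneg hM))
  rw [frobNorm_sq, sq, Matrix.trace, Finset.sum_mul_sum]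
  refine Finset.sum_le_sum fun i _ => Finset.sum_le_sum fun j _ => ?_
  have h : M i j = ∑ k, CFC.sqrt M k i * CFC.sqrt M k j := by
    conv_lhs => rw [← sqrt_mul_sqrt_of_posSemidef hM, Matrix.mul_apply]
    refine Finset.sum_congr rfl fun k _ => ?_
    rw [← Matrix.transpose_apply (CFC.sqrt M) i k, transpose_sqrt]
  rw [h, Matrix.diag_apply, Matrix.diag_apply, ← sum_sq_sqrt_col hM i, ← sum_sq_sqrt_col hM j]
  exact Finset.sum_mul_sq_le_sq_mul_sq _ _ _

end Norms

/-! ### Consequences of the conditions and the order of the bound -/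

section Consequences

variable {n m : ℕ} {A : Matrix (Fin m) (Fin m) ℝ} {B : Matrix (Fin n) (Fin n) ℝ}

lemma Conditions.log_pos (h : Conditions A B) : 0 < Real.log m :=
  Real.log_pos (by have := h.sixteen_le; exact_mod_cast (by omega : 1 < m))

lemma Conditions.opNorm_pos (h : Conditions A B) : 0 < opNorm B := by
  refine (opNorm_nonneg B).lt_of_ne fun h0 => ?_
  have := h.stableRank_B
  rw [← h0] at this
  simp only [ne_eq, OfNat.ofNat_ne_zero, not_false_eq_true, zero_pow, div_zero] at this
  exact absurd h.log_pos this.not_gt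

lemma Conditions.log_mul_le (h : Conditions A B) : Real.log m * opNorm B ^ 2 ≤ frobNorm B ^ 2 :=
  (le_div_iff₀ (pow_pos h.opNorm_pos 2)).1 h.stableRank_B

lemma Conditions.frobNorm_pos (h : Conditions A B) : 0 < frobNorm B := by
  have h1 := h.log_mul_le
  have h2 : 0 < Real.log m * opNorm B ^ 2 := mul_pos h.log_pos (pow_pos h.opNorm_pos 2)
  exact (frobNorm_nonneg B).lt_of_ne fun h0 => by rw [← h0] at h1; linarith

lemma Conditions.log_le (h : Conditions A B) : Real.log m ≤ n :=
  le_of_mul_le_mul_right (h.log_mul_le.trans (frobNorm_sq_le_mul_opNorm_sq B))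
    (pow_pos h.opNorm_pos 2)

lemma Conditions.n_pos (h : Conditions A B) : (0 : ℝ) < n := h.log_pos.trans_le h.log_le

lemma Conditions.m_pos (h : Conditions A B) : (0 : ℝ) < m := by
  have := h.sixteen_le
  exact_mod_cast (by omega : 0 < m)

lemma Conditions.log_mul_opNorm_le_trace (h : Conditions A B) :
    Real.log m * opNorm B ≤ B.trace := by
  have h1 := h.log_mul_le.trans (frobNorm_sq_le_opNorm_mul_trace h.posSemidef_B)
  refine le_of_mul_le_mul_left ?_ h.opNorm_pos
  linarith

lemma Conditions.trace_pos (h : Conditions A B) : 0 < B.trace :=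
  (mul_pos h.log_pos h.opNorm_pos).trans_le h.log_mul_opNorm_le_trace

lemma Conditions.tau_nonneg (h : Conditions A B) : 0 ≤ tau B :=
  div_nonneg h.trace_pos.le h.n_pos.le

lemma Conditions.tau_le_opNorm (h : Conditions A B) : tau B ≤ opNorm B :=
  (div_le_iff₀ h.n_pos).2 ((trace_le_mul_opNorm B).trans_eq (mul_comm _ _))

lemma Conditions.one_le_diagMax (h : Conditions A B) : 1 ≤ diagMax A := by
  have h1 := trace_le_mul_diagMax A
  rw [h.trace_A] at h1
  exact le_of_mul_le_mul_left (by linarith) h.m_pos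

lemma D1_nonneg (A : Matrix (Fin m) (Fin m) ℝ) (B : Matrix (Fin n) (Fin n) ℝ) : 0 ≤ D1 A B :=
  add_nonneg (div_nonneg (frobNorm_nonneg _) (Real.sqrt_nonneg _))
    (div_nonneg (frobNorm_nonneg _) (Real.sqrt_nonneg _))

/-- `r_{m,m}` is smaller than `r_{m,n}` by a factor of order `√m`, which brings the `D₁` term down
to order `ψ₀`. For `A` it suffices that `‖A‖_F ≤ tr A = m` and `1 ≤ a_max`. -/
lemma Conditions.D1_div_sqrt_le (h : Conditions A B) :
    D1 A B / √m ≤ opNorm B + diagMax A := by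
  have hm := h.m_pos
  have hn := h.n_pos
  have hm1 : 1 ≤ √(m : ℝ) := by
    rw [Real.one_le_sqrt]
    exact_mod_cast (by have := h.sixteen_le; omega : 1 ≤ m)
  have hA : frobNorm A / √m / √m ≤ diagMax A := by
    rw [div_div, Real.mul_self_sqrt hm.le]
    have := frobNorm_le_trace h.posSemidef_A
    rw [h.trace_A] at this
    exact ((div_le_one hm).2 this).trans h.one_le_diagMax
  have hB : frobNorm B / √n ≤ opNorm B := by
    rw [div_le_iff₀ (Real.sqrt_pos.2 hn)]
    refine (le_abs_self _).trans (abs_le_of_sq_le_sq ?_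
      (mul_nonneg (opNorm_nonneg B) (Real.sqrt_nonneg _)))
    rw [mul_pow, Real.sq_sqrt hn.le, mul_comm]
    exact frobNorm_sq_le_mul_opNorm_sq B
  have hB0 : 0 ≤ frobNorm B / √n := div_nonneg (frobNorm_nonneg _) (Real.sqrt_nonneg _)
  rw [D1, add_div]
  linarith [div_le_self hB0 hm1]

lemma Conditions.deviationBound_le (h : Conditions A B) {C₀ : ℝ} (hC : 0 < C₀) (K : ℝ) :
    deviationBound C₀ K A B ≤ (16 + 8 * C₀) * (psi0 C₀ K A B * √(Real.log m / n)) := by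
  set a := diagMax A
  set b := opNorm B
  have hb := h.opNorm_pos
  have ha : 0 < a := one_pos.trans_le h.one_le_diagMax
  have hD1 := h.D1_div_sqrt_le
  have h0 : √(tau B) * D0' A B + a ≤ 2 * (b + a) := by
    have h1 : √(tau B) ≤ √b := Real.sqrt_le_sqrt h.tau_le_opNorm
    have h2 : √(tau B) * D0' A B ≤ √b * (√b + √a) := by
      unfold D0'
      gcongr
    nlinarith [Real.sq_sqrt hb.le, Real.sq_sqrt ha.le, sq_nonneg (√b - √a)]
  have hs : √(Real.log m / (m * n)) = √(Real.log m / n) / √m := by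
    rw [← Real.sqrt_div' _ h.m_pos.le, div_div, mul_comm (n : ℝ)]
  unfold deviationBound rmn rmm psi0
  rw [hs]
  set r := √(Real.log m / n)
  have hr : 0 ≤ r := Real.sqrt_nonneg _
  have e : 4 * C₀ * D1 A B * (2 * C₀ * K ^ 2 * (r / √m)) =
      (8 * C₀ ^ 2 * K ^ 2 * r) * (D1 A B / √m) := by ring
  rw [e]
  have h3 : (8 * C₀ ^ 2 * K ^ 2 * r) * (D1 A B / √m) ≤ (8 * C₀ ^ 2 * K ^ 2 * r) * (b + a) := by
    gcongr
  have h4 : (√(tau B) * D0' A B + a) * (8 * (C₀ * K ^ 2 * r)) ≤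
      2 * (b + a) * (8 * (C₀ * K ^ 2 * r)) := by gcongr
  linarith

lemma Conditions.le_deviationBound (h : Conditions A B) {C₀ : ℝ} (hC : 0 < C₀) (K : ℝ) {κ : ℝ}
    (hκ : 0 < κ) (hB : opNorm B ≤ κ * tau B) :
    min 1 (1 / √κ) * (psi0 C₀ K A B * √(Real.log m / n)) ≤ deviationBound C₀ K A B := by
  have ha : 0 < diagMax A := one_pos.trans_le h.one_le_diagMax
  have hb := h.opNorm_pos
  have hτ := h.tau_nonneg
  have h1 : √(opNorm B) ≤ √κ * √(tau B) := by
    rw [← Real.sqrt_mul hκ.le]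
    exact Real.sqrt_le_sqrt hB
  have hκ' := Real.sqrt_pos.2 hκ
  -- Only the product `√τ_B √‖B‖` inside `√τ_B D₀'` is needed to recover `‖B‖`.
  have h2 : 1 / √κ * opNorm B ≤ √(tau B) * D0' A B := by
    rw [div_mul_eq_mul_div, one_mul, div_le_iff₀ hκ']
    calc opNorm B = √(opNorm B) * √(opNorm B) := (Real.mul_self_sqrt hb.le).symm
      _ ≤ √κ * √(tau B) * √(opNorm B) := by gcongr
      _ ≤ √κ * √(tau B) * D0' A B := by
          gcongr
          exact le_add_of_nonneg_right (Real.sqrt_nonneg _)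
      _ = _ := by ring
  have h3 : min 1 (1 / √κ) * (opNorm B + diagMax A) ≤ √(tau B) * D0' A B + diagMax A := by
    rw [mul_add]
    refine add_le_add (le_trans ?_ h2) ?_
    · gcongr
      exact min_le_right _ _
    · exact (mul_le_mul_of_nonneg_right (min_le_left _ _) ha.le).trans_eq (one_mul _)
  have h4 : 0 ≤ √(tau B) * D0' A B + diagMax A :=
    add_nonneg (mul_nonneg (Real.sqrt_nonneg _)
      (add_nonneg (Real.sqrt_nonneg _) (Real.sqrt_nonneg _))) ha.le
  have hD := D1_nonneg A B
  have h5 : 0 ≤ 4 * C₀ * D1 A B * rmm C₀ K n m := by unfold rmm; positivity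
  unfold deviationBound rmn psi0 at *
  set r := √(Real.log m / n)
  have h6 : 0 ≤ C₀ * K ^ 2 * r := by positivity
  have h7 := mul_le_mul_of_nonneg_right h3 h6
  have h8 := mul_nonneg h4 h6
  linarith

end Consequences

/-! ### Polarization and the trace correction -/

section Deterministic

variable {n m : ℕ}

/-- The deviation `(1/n) Xᵀ X - A - τ I` of the Gram matrix. -/
def gramDeviation (A : Matrix (Fin m) (Fin m) ℝ) (τ : ℝ) (X : Matrix (Fin n) (Fin m) ℝ) :
    Matrix (Fin m) (Fin m) ℝ :=
  (1 / n : ℝ) • (Xᵀ * X) - A - τ • (1 : Matrix (Fin m) (Fin m) ℝ)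

lemma dotProduct_gramDeviation (A : Matrix (Fin m) (Fin m) ℝ) (τ : ℝ)
    (X : Matrix (Fin n) (Fin m) ℝ) (u : Fin m → ℝ) :
    u ⬝ᵥ (gramDeviation A τ X *ᵥ u) =
      1 / n * ∑ k, (X *ᵥ u) k ^ 2 - u ⬝ᵥ (A *ᵥ u) - τ * ∑ i, u i ^ 2 := by
  have h : u ⬝ᵥ ((Xᵀ * X) *ᵥ u) = ∑ k, (X *ᵥ u) k ^ 2 := by
    rw [← Matrix.mulVec_mulVec, Matrix.dotProduct_mulVec, Matrix.vecMul_transpose]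
    simp [dotProduct, sq]
  rw [gramDeviation, Matrix.sub_mulVec, Matrix.sub_mulVec, dotProduct_sub, dotProduct_sub,
    Matrix.smul_mulVec, Matrix.smul_mulVec, dotProduct_smul, dotProduct_smul, h,
    Matrix.one_mulVec]
  simp [dotProduct, sq]

/-- Entries of a symmetric matrix are controlled by its quadratic form on sums of two basis
vectors. -/
lemma abs_apply_le_of_quadratic {T : Matrix (Fin m) (Fin m) ℝ} (hT : Tᵀ = T) {β : ℝ}
    (h : ∀ i j, |(Pi.single i 1 + Pi.single j 1 : Fin m → ℝ) ⬝ᵥ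
      (T *ᵥ (Pi.single i 1 + Pi.single j 1))| ≤ β) (i j : Fin m) : |T i j| ≤ 3 / 4 * β := by
  have hq : ∀ i j, (Pi.single i 1 + Pi.single j 1 : Fin m → ℝ) ⬝ᵥ
      (T *ᵥ (Pi.single i 1 + Pi.single j 1)) = T i i + 2 * T i j + T j j := by
    intro i j
    have hs : T j i = T i j := by conv_rhs => rw [← hT, Matrix.transpose_apply]
    simp only [Matrix.mulVec_add, dotProduct_add, add_dotProduct, Matrix.mulVec_single_one,
      single_one_dotProduct, Matrix.col_apply]
    rw [hs]; ring
  have h1 := abs_le.1 (hq i j ▸ h i j)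
  have h2 := abs_le.1 (hq i i ▸ h i i)
  have h3 := abs_le.1 (hq j j ▸ h j j)
  -- With `q_ij` the form at `e_i + e_j`, one has `q_ii = 4 T_ii`, so `T_ij = q_ij/2 - (q_ii +
  -- q_jj)/8`; hence the factor `1/2 + 1/4`.
  exact abs_le.2 ⟨by linarith [h1.1, h2.2, h3.2], by linarith [h1.2, h2.1, h3.1]⟩

/-- The estimator is the positive part of `τ + tr(D)/m`, with `D` the Gram deviation. The positive
part is 1-Lipschitz and fixes `τ ≥ 0`, so its error is at most the mean of the diagonal deviations,
one more `β`. -/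
lemma maxNorm_gammaHat_sub_le {A : Matrix (Fin m) (Fin m) ℝ} {τ β : ℝ}
    {X : Matrix (Fin n) (Fin m) ℝ} (hn : (0 : ℝ) < n) (hm : (0 : ℝ) < m) (hA : A.trace = m)
    (hτ : 0 ≤ τ) (h : ∀ i j, |gramDeviation A τ X i j| ≤ β) :
    maxNorm (gammaHat A.trace X - A) ≤ 2 * β := by
  have hm' : 0 < m := by exact_mod_cast hm
  have : Nonempty (Fin m) := ⟨⟨0, hm'⟩⟩
  set D := gramDeviation A τ X with hD
  have htr : D.trace = 1 / n * frobNorm X ^ 2 - m - τ * m := by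
    have h1 : (Xᵀ * X).trace = frobNorm X ^ 2 := by
      rw [frobNorm_sq, Finset.sum_comm]
      simp [Matrix.trace, Matrix.mul_apply, sq]
    rw [hD, gramDeviation, Matrix.trace_sub, Matrix.trace_sub, Matrix.trace_smul,
      Matrix.trace_smul, h1, hA, Matrix.trace_one]
    simp
  have htr_le : |D.trace| ≤ m * β := by
    refine (Finset.abs_sum_le_sum_abs _ _).trans
      ((Finset.sum_le_sum fun i _ => h i i).trans_eq ?_)
    simp
  have htau : tauHat A.trace X = max (D.trace / m + τ) 0 := by
    have h1 : frobNorm X ^ 2 - n * (m : ℝ) = n * m * (D.trace / m + τ) := by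
      rw [htr]; field_simp; ring
    have h2 : max (n * m * (D.trace / m + τ)) 0 = n * m * max (D.trace / m + τ) 0 := by
      rw [mul_max_of_nonneg _ _ (by positivity), mul_zero]
    rw [tauHat, trHat, hA, h1, h2]
    field_simp
  have htau_le : |tauHat A.trace X - τ| ≤ β := by
    rw [htau]
    have h1 : |max (D.trace / m + τ) 0 - max τ 0| ≤ |D.trace / m + τ - τ| :=
      abs_max_sub_max_le_abs _ _ _
    rw [max_eq_left hτ, add_sub_cancel_right, abs_div, abs_of_pos hm] at h1
    exact h1.trans ((div_le_iff₀ hm).2 (by linarith))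
  have hsub : gammaHat A.trace X - A = D - (tauHat A.trace X - τ) • 1 := by
    rw [hD, gramDeviation, gammaHat, sub_smul]
    abel
  refine ciSup_le fun ij => ?_
  rw [hsub, Matrix.sub_apply, Matrix.smul_apply, smul_eq_mul]
  have h1 : |(tauHat A.trace X - τ) * (1 : Matrix (Fin m) (Fin m) ℝ) ij.1 ij.2| ≤ β := by
    rw [Matrix.one_apply]
    split_ifs
    · rwa [mul_one]
    · rw [mul_zero, abs_zero]
      exact (abs_nonneg _).trans htau_le
  have h2 := abs_sub (D ij.1 ij.2) ((tauHat A.trace X - τ) * (1 : Matrix _ _ ℝ) ij.1 ij.2)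
  linarith [h ij.1 ij.2]

/-- Expansion of `|X u|²` for the Kronecker sum model. -/
lemma sum_sq_dataMatrix_mulVec {A : Matrix (Fin m) (Fin m) ℝ} {B : Matrix (Fin n) (Fin n) ℝ}
    (hB : B.PosSemidef) (Z₁ Z₂ : Matrix (Fin n) (Fin m) ℝ) (u : Fin m → ℝ) :
    ∑ k, (dataMatrix A B Z₁ Z₂ *ᵥ u) k ^ 2 =
      (Z₁ *ᵥ (CFC.sqrt A *ᵥ u)) ⬝ᵥ (Z₁ *ᵥ (CFC.sqrt A *ᵥ u)) +
      2 * ((Z₁ *ᵥ (CFC.sqrt A *ᵥ u)) ⬝ᵥ (CFC.sqrt B *ᵥ (Z₂ *ᵥ u))) +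
      (Z₂ *ᵥ u) ⬝ᵥ (B *ᵥ (Z₂ *ᵥ u)) := by
  rw [dataMatrix, Matrix.add_mulVec, ← Matrix.mulVec_mulVec, ← Matrix.mulVec_mulVec,
    ← sum_sq_sqrt_mulVec hB]
  simp only [dotProduct, Pi.add_apply, Finset.mul_sum, ← Finset.sum_add_distrib]
  exact Finset.sum_congr rfl fun k _ => by ring

end Deterministic

/-! ### Images of fixed vectors under the random matrices -/

section Ensemble

variable {Ω : Type*} [MeasurableSpace Ω] {μ : Measure Ω} {n m : ℕ} {K : ℝ}
  {Z : Ω → Matrix (Fin n) (Fin m) ℝ}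

lemma IsSubgaussianEnsemble.integral_sq (hZ : IsSubgaussianEnsemble μ K Z) (k : Fin n)
    (j : Fin m) : ∫ ω, Z ω k j ^ 2 ∂μ = 1 :=
  integral_sq_eq_one (hZ.measurable k j) (hZ.mean_zero k j) (hZ.variance_one k j)

lemma IsSubgaussianEnsemble.one_le [IsProbabilityMeasure μ] (hZ : IsSubgaussianEnsemble μ K Z)
    (k : Fin n) (j : Fin m) : 1 ≤ K :=
  one_le_of_psiTwoNorm_le (hZ.measurable k j) (hZ.integral_sq k j) (hZ.psiTwoNorm_le k j)

lemma IsSubgaussianEnsemble.iIndepFun_row (hZ : IsSubgaussianEnsemble μ K Z) (k : Fin n) :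
    iIndepFun (fun j ω => Z ω k j) μ :=
  hZ.indep.precomp (g := fun j : Fin m => (k, j)) fun a b hab => by simpa using hab

lemma IsSubgaussianEnsemble.isSubGaussian_mulVec [IsProbabilityMeasure μ]
    (hZ : IsSubgaussianEnsemble μ K Z) (hK : 0 < K) (w : Fin m → ℝ) (k : Fin n) :
    IsSubGaussian μ (8 * K ^ 2 * ∑ j, w j ^ 2) (fun ω => (Z ω *ᵥ w) k) := by
  have := IsSubGaussian.linearCombination (fun j => isSubGaussian_of_psiTwoNorm_le
    (hZ.measurable k j) (hZ.mean_zero k j) hK (hZ.psiTwoNorm_le k j)) (hZ.iIndepFun_row k) w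
  simpa only [Matrix.mulVec, dotProduct, mul_comm (w _)] using this

lemma IsSubgaussianEnsemble.integral_sq_mulVec (hZ : IsSubgaussianEnsemble μ K Z)
    (w : Fin m → ℝ) (k : Fin n) : ∫ ω, (Z ω *ᵥ w) k ^ 2 ∂μ = ∑ j, w j ^ 2 := by
  have := integral_sq_linearCombination (hZ.measurable k) (hZ.iIndepFun_row k) (hZ.mean_zero k)
    (hZ.integral_sq k) w
  simpa only [Matrix.mulVec, dotProduct, mul_comm (w _)] using this

lemma IsSubgaussianEnsemble.iIndepFun_mulVec (hZ : IsSubgaussianEnsemble μ K Z)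
    (w : Fin m → ℝ) : iIndepFun (fun k ω => (Z ω *ᵥ w) k) μ :=
  (iIndepFun_rows (fun p => hZ.measurable p.1 p.2) hZ.indep).comp
    (fun _ (x : Fin m → ℝ) => x ⬝ᵥ w) fun _ => by unfold dotProduct; fun_prop

lemma IndepMatrix.indepFun_mulVec {Z₁ Z₂ : Ω → Matrix (Fin n) (Fin m) ℝ}
    (h : IndepMatrix μ Z₁ Z₂) (w u : Fin m → ℝ) :
    IndepFun (fun ω k => (Z₁ ω *ᵥ w) k) (fun ω k => (Z₂ ω *ᵥ u) k) μ := by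
  have hm : ∀ w : Fin m → ℝ,
      Measurable fun (x : Fin n × Fin m → ℝ) (k : Fin n) => ∑ j, x (k, j) * w j := by
    intro w; fun_prop
  exact IndepFun.comp h (hm w) (hm u)

end Ensemble

/-! ### Concentration at fixed vectors and the union bound -/

section Probability

variable {Ω : Type*} [MeasurableSpace Ω] {μ : Measure Ω} [IsProbabilityMeasure μ] {n m : ℕ} {K : ℝ}
  {A : Matrix (Fin m) (Fin m) ℝ} {B : Matrix (Fin n) (Fin n) ℝ}
  {Z₁ Z₂ : Ω → Matrix (Fin n) (Fin m) ℝ}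

/-- Deviations of the quadratic form of `(1/n) Xᵀ X - A - τ_B I` at a fixed vector. -/
lemma measure_quadratic_gramDeviation_le (h : Conditions A B) (hK : 0 < K)
    (h1 : IsSubgaussianEnsemble μ K Z₁) (h2 : IsSubgaussianEnsemble μ K Z₂)
    (h12 : IndepMatrix μ Z₁ Z₂) {u : Fin m → ℝ} (hu : ∑ i, u i ^ 2 ≤ 4)
    (hAu : u ⬝ᵥ (A *ᵥ u) ≤ 4 * diagMax A) :
    μ {ω | 6400 * K ^ 2 * √(Real.log m / n) * (√(tau B) * D0' A B + diagMax A) <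
      |u ⬝ᵥ (gramDeviation A (tau B) (dataMatrix A B (Z₁ ω) (Z₂ ω)) *ᵥ u)|} ≤
      10 * ENNReal.ofReal (Real.exp (-(4 * Real.log m))) := by
  set a := diagMax A with ha
  set T := Real.log m with hT
  set w := CFC.sqrt A *ᵥ u with hw
  have ha0 : 0 < a := one_pos.trans_le h.one_le_diagMax
  have hn := h.n_pos
  have hB := h.posSemidef_B
  have hT0 : 0 < T := h.log_pos
  have hb0 := h.opNorm_pos
  have htr0 := h.trace_pos
  have hww : ∑ i, w i ^ 2 = u ⬝ᵥ (A *ᵥ u) := sum_sq_sqrt_mulVec h.posSemidef_A u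
  -- Both `|u|² ≤ 4` and `|w|² ≤ 4 a_max`, so the proxies `8K²|u|²` and `8K²|w|²` are at most `c`
  -- and `c a_max`.
  set c := 32 * K ^ 2 with hc
  have hc0 : 0 < c := by positivity
  have hg : ∀ k, IsSubGaussian μ (c * a) (fun ω => (Z₁ ω *ᵥ w) k) := fun k =>
    (h1.isSubGaussian_mulVec hK w k).mono (by rw [hww]; nlinarith [sq_nonneg K])
  have hh : ∀ k, IsSubGaussian μ c (fun ω => (Z₂ ω *ᵥ u) k) := fun k =>
    (h2.isSubGaussian_mulVec hK u k).mono (by nlinarith [sq_nonneg K])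
  have hn1 : ∑ k, ∑ i, (1 : Matrix (Fin n) (Fin n) ℝ) k i ^ 2 = √(n : ℝ) ^ 2 := by
    rw [Real.sq_sqrt hn.le]
    simp [Matrix.one_apply]
  have b1 := measure_quadratic_deviation_le hg (h1.iIndepFun_mulVec w) (mul_pos hc0 ha0)
    (h1.integral_sq_mulVec w) 1 (L := 1) (by simp) hn1 (Real.sqrt_pos.2 hn) hT0.le
    (by rw [Real.sq_sqrt hn.le, mul_one]; exact h.log_le)
  have b2 := measure_quadratic_deviation_le hh (h2.iIndepFun_mulVec u) hc0
    (h2.integral_sq_mulVec u) B (sum_sq_mulVec_le_opNorm B) (frobNorm_sq B).symm h.frobNorm_pos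
    hT0.le h.log_mul_le
  have b3 := measure_bilinear_deviation_le (e := c * √a) (F := √B.trace) (T := T) hg
    (h1.iIndepFun_mulVec w) hh (h2.iIndepFun_mulVec u) (h12.indepFun_mulVec w u) (CFC.sqrt B)
    (L := opNorm B)
    (fun x => (sum_sq_sqrt_mulVec hB x).le.trans (dotProduct_mulVec_le_opNorm B x))
    hc0.le (mul_pos hc0 ha0).le (mul_pos hc0 (Real.sqrt_pos.2 ha0))
    (by rw [mul_pow, Real.sq_sqrt ha0.le]; ring)
    (by rw [Real.sq_sqrt htr0.le, sum_sq_sqrt hB]) (Real.sqrt_pos.2 htr0) hT0.le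
    (by rw [Real.sq_sqrt htr0.le]; exact h.log_mul_opNorm_le_trace)
  -- The constant is `6400 = 200 · 32`. The cross term has coefficient only `2 · 9 = 18`, and `‖B‖_F
  -- ≤ √(‖B‖ tr B)` produces the `√τ_B √‖B‖` term.
  have hbound : 200 * (c * a) * √T * √n + 200 * c * √T * frobNorm B +
      2 * (9 * (c * √a) * √T * √B.trace) ≤
      n * (6400 * K ^ 2 * √(T / n) * (√(tau B) * D0' A B + a)) := by
    have e1 : √(T / n) = √T / √n := Real.sqrt_div' _ hn.le
    have e2 : √B.trace = √n * √(tau B) := by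
      rw [← Real.sqrt_mul hn.le, tau, mul_div_cancel₀ _ hn.ne']
    have e3 : frobNorm B ≤ √(opNorm B) * √B.trace := by
      rw [← Real.sqrt_mul hb0.le]
      exact Real.le_sqrt_of_sq_le (frobNorm_sq_le_opNorm_mul_trace hB)
    have hsn := Real.sqrt_pos.2 hn
    have e4 : (n : ℝ) * (6400 * K ^ 2 * √(T / n) * (√(tau B) * D0' A B + a)) =
        200 * c * √T * √n * (√(tau B) * (√(opNorm B) + √a) + a) := by
      rw [e1, hc, D0']
      nth_rewrite 1 [← Real.sq_sqrt hn.le]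
      field_simp
      ring
    have e5 : 200 * c * √T * frobNorm B ≤ 200 * c * √T * (√(opNorm B) * (√n * √(tau B))) := by
      rw [← e2]; gcongr
    have e6 : 0 ≤ c * √T * √n * √(tau B) * √a := by positivity
    rw [e4, e2]
    nlinarith
  refine (measure_mono ?_).trans ((measure_union_le _ _).trans ((add_le_add
    (measure_union_le _ _) le_rfl).trans ((add_le_add (add_le_add b1 b2) b3).trans_eq (by ring))))
  intro ω hω
  by_contra hcon
  simp only [Set.mem_union, Set.mem_ofPred_eq, not_or, not_lt] at hcon hω
  obtain ⟨⟨c1, c2⟩, c3⟩ := hcon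
  rw [Matrix.one_mulVec, Matrix.trace_one, Fintype.card_fin] at c1
  rw [dotProduct_gramDeviation, sum_sq_dataMatrix_mulVec hB, ← hw, ← hww] at hω
  have hτ : B.trace = n * tau B := by rw [tau, mul_div_cancel₀ _ hn.ne']
  have key : n * (1 / n * ((Z₁ ω *ᵥ w) ⬝ᵥ (Z₁ ω *ᵥ w) +
      2 * ((Z₁ ω *ᵥ w) ⬝ᵥ (CFC.sqrt B *ᵥ (Z₂ ω *ᵥ u))) + (Z₂ ω *ᵥ u) ⬝ᵥ (B *ᵥ (Z₂ ω *ᵥ u))) -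
      ∑ i, w i ^ 2 - tau B * ∑ i, u i ^ 2) =
      ((Z₁ ω *ᵥ w) ⬝ᵥ (Z₁ ω *ᵥ w) - (∑ i, w i ^ 2) * n) +
      2 * ((Z₁ ω *ᵥ w) ⬝ᵥ (CFC.sqrt B *ᵥ (Z₂ ω *ᵥ u))) +
      ((Z₂ ω *ᵥ u) ⬝ᵥ (B *ᵥ (Z₂ ω *ᵥ u)) - (∑ i, u i ^ 2) * B.trace) := by
    rw [hτ]; field_simp; ring
  have hω2 := mul_lt_mul_of_pos_left hω hn
  have habs : ∀ x : ℝ, n * |x| = |n * x| := fun x => by rw [abs_mul, abs_of_pos hn]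
  rw [habs, key] at hω2
  replace c1 : |(Z₁ ω *ᵥ w) ⬝ᵥ (Z₁ ω *ᵥ w) - (∑ i, w i ^ 2) * n| ≤ _ := c1
  replace c2 : |(Z₂ ω *ᵥ u) ⬝ᵥ (B *ᵥ (Z₂ ω *ᵥ u)) - (∑ i, u i ^ 2) * B.trace| ≤ _ := c2
  replace c3 : |(Z₁ ω *ᵥ w) ⬝ᵥ (CFC.sqrt B *ᵥ (Z₂ ω *ᵥ u))| ≤ _ := c3
  have d1 := abs_le.1 c1
  have d2 := abs_le.1 c2
  have d3 := abs_le.1 c3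
  rcases lt_abs.1 hω2 with hω3 | hω3 <;> linarith [d1.1, d1.2, d2.1, d2.2, d3.1, d3.2]

/-- With probability at least `1 - 12 / m²`, the entrywise deviation is at most
`deviationBound 1200 K A B`. -/
lemma Conditions.le_measureReal_maxNorm_le (h : Conditions A B)
    (h1 : IsSubgaussianEnsemble μ K Z₁) (h2 : IsSubgaussianEnsemble μ K Z₂)
    (h12 : IndepMatrix μ Z₁ Z₂) :
    1 - 12 / (m : ℝ) ^ 2 ≤
      μ.real {ω | maxNorm (gammaHat A.trace (dataMatrix A B (Z₁ ω) (Z₂ ω)) - A) ≤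
        deviationBound 1200 K A B} := by
  have hn := h.n_pos
  have hm := h.m_pos
  have hK : 0 < K := one_pos.trans_le
    (h1.one_le ⟨0, by exact_mod_cast hn⟩ ⟨0, by exact_mod_cast hm⟩)
  set β := 6400 * K ^ 2 * √(Real.log m / n) * (√(tau B) * D0' A B + diagMax A) with hβ
  set e : Fin m × Fin m → Fin m → ℝ := fun p => Pi.single p.1 1 + Pi.single p.2 1 with he
  set bad : Fin m × Fin m → Set Ω := fun p =>
    {ω | β < |e p ⬝ᵥ (gramDeviation A (tau B) (dataMatrix A B (Z₁ ω) (Z₂ ω)) *ᵥ e p)|} with hbad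
  set good : Set Ω := {ω | maxNorm (gammaHat A.trace (dataMatrix A B (Z₁ ω) (Z₂ ω)) - A) ≤
        deviationBound 1200 K A B} with hgood
  have hsq : ∀ (x y : Fin m → ℝ), ∑ i, (x + y) i ^ 2 ≤ 2 * ∑ i, x i ^ 2 + 2 * ∑ i, y i ^ 2 := by
    intro x y
    rw [Finset.mul_sum, Finset.mul_sum, ← Finset.sum_add_distrib]
    refine Finset.sum_le_sum fun i _ => ?_
    rw [Pi.add_apply]
    nlinarith [sq_nonneg (x i - y i)]
  have hbad_le : ∀ p, μ (bad p) ≤ 10 * ENNReal.ofReal (Real.exp (-(4 * Real.log m))) := by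
    intro p
    refine measure_quadratic_gramDeviation_le h hK h1 h2 h12 ?_ ?_
    · refine (hsq _ _).trans ?_
      simp [Pi.single_apply]
      norm_num
    · rw [← sum_sq_sqrt_mulVec h.posSemidef_A, he]
      simp only [Matrix.mulVec_add]
      refine (hsq _ _).trans ?_
      simp only [Matrix.mulVec_single_one, Matrix.col_apply]
      rw [sum_sq_sqrt_col h.posSemidef_A, sum_sq_sqrt_col h.posSemidef_A]
      linarith [apply_le_diagMax A p.1, apply_le_diagMax A p.2]
  have hexp : Real.exp (-(4 * Real.log m)) = 1 / (m : ℝ) ^ 4 := by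
    rw [Real.exp_neg, show 4 * Real.log m = ((4 : ℕ) : ℝ) * Real.log m by norm_num,
      Real.exp_nat_mul, Real.exp_log hm, one_div]
  -- Covering the whole space and using subadditivity avoids any measurability claim about `good`.
  have hcover : (Set.univ : Set Ω) ⊆ good ∪ ⋃ p, bad p := by
    intro ω _
    by_contra hcon
    simp only [Set.mem_union, Set.mem_iUnion, not_or, not_exists] at hcon
    refine hcon.1 ?_
    have hX := hcon.2
    simp only [hbad, Set.mem_ofPred_eq, not_lt] at hX
    have hsymm : (gramDeviation A (tau B) (dataMatrix A B (Z₁ ω) (Z₂ ω)))ᵀ =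
        gramDeviation A (tau B) (dataMatrix A B (Z₁ ω) (Z₂ ω)) := by
      have hA : Aᵀ = A := by
        have := h.posSemidef_A.isHermitian
        rwa [Matrix.IsHermitian, Matrix.conjTranspose_eq_transpose_of_trivial] at this
      simp [gramDeviation, Matrix.transpose_mul, hA]
    have hle := maxNorm_gammaHat_sub_le hn hm h.trace_A h.tau_nonneg
      (abs_apply_le_of_quadratic hsymm fun i j => hX (i, j))
    refine hle.trans ?_
    -- Polarization and the trace correction cost `2 · 3/4`, and `3/2 · 6400 = 8 · 1200`, so the
    -- first term of the bound suffices.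
    have hD := D1_nonneg A B
    have h5 : 0 ≤ 4 * 1200 * D1 A B * rmm 1200 K n m := by unfold rmm; positivity
    rw [deviationBound, rmn, hβ]
    have h6 : 0 ≤ K ^ 2 * √(Real.log m / n) * (√(tau B) * D0' A B + diagMax A) := by
      have := one_pos.trans_le h.one_le_diagMax
      unfold D0'
      positivity
    linarith
  have hunion : μ (⋃ p, bad p) ≤ ENNReal.ofReal (12 / (m : ℝ) ^ 2) := by
    refine (measure_iUnion_fintype_le μ bad).trans
      ((Finset.sum_le_sum fun p _ => hbad_le p).trans ?_)
    rw [Finset.sum_const, Finset.card_univ, Fintype.card_prod, Fintype.card_fin, hexp,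
      nsmul_eq_mul, ← ENNReal.ofReal_natCast, ← ENNReal.ofReal_ofNat,
      ← ENNReal.ofReal_mul (by positivity), ← ENNReal.ofReal_mul (by positivity)]
    refine ENNReal.ofReal_le_ofReal ?_
    -- There are `m²` vectors, each failing with probability at most `10 m⁻⁴`.
    push_cast
    have : (m : ℝ) * m * (10 * (1 / (m : ℝ) ^ 4)) = 10 / (m : ℝ) ^ 2 := by field_simp
    rw [this]
    gcongr
    norm_num
  have htotal : 1 ≤ μ.real good + μ.real (⋃ p, bad p) := by
    rw [← probReal_univ (μ := μ)]
    exact (measureReal_mono hcover).trans (measureReal_union_le _ _)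
  have : μ.real (⋃ p, bad p) ≤ 12 / (m : ℝ) ^ 2 :=
    ENNReal.toReal_le_of_le_ofReal (by positivity) hunion
  linarith

end Probability

end KroneckerSum

end

theorem mainTheorem6 :
    ∃ C₀ : ℝ, 0 < C₀ ∧
      -- the probability bound
      (∀ {n m : ℕ} (A : Matrix (Fin m) (Fin m) ℝ) (B : Matrix (Fin n) (Fin n) ℝ) (K : ℝ),
        KroneckerSum.Conditions A B →
        ∀ {Ω : Type*} [MeasurableSpace Ω] (μ : Measure Ω) [IsProbabilityMeasure μ]
          (Z₁ Z₂ : Ω → Matrix (Fin n) (Fin m) ℝ),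
          KroneckerSum.IsSubgaussianEnsemble μ K Z₁ →
          KroneckerSum.IsSubgaussianEnsemble μ K Z₂ →
          KroneckerSum.IndepMatrix μ Z₁ Z₂ →
          1 - 12 / (m : ℝ) ^ 2 ≤
            μ.real {ω | KroneckerSum.maxNorm
                (KroneckerSum.gammaHat A.trace (KroneckerSum.dataMatrix A B (Z₁ ω) (Z₂ ω)) - A) ≤
              KroneckerSum.deviationBound C₀ K A B}) ∧
      -- the bound is at most of order `ψ₀ √(log m / n)`
      (∃ C : ℝ, 0 < C ∧
        ∀ {n m : ℕ} (A : Matrix (Fin m) (Fin m) ℝ) (B : Matrix (Fin n) (Fin n) ℝ) (K : ℝ),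
          KroneckerSum.Conditions A B →
          KroneckerSum.deviationBound C₀ K A B ≤
            C * (KroneckerSum.psi0 C₀ K A B * Real.sqrt (Real.log m / n))) ∧
      -- and exactly of this order as long as `‖B‖₂ = O(τ_B)`
      (∀ κ : ℝ, 0 < κ → ∃ c : ℝ, 0 < c ∧
        ∀ {n m : ℕ} (A : Matrix (Fin m) (Fin m) ℝ) (B : Matrix (Fin n) (Fin n) ℝ) (K : ℝ),
          KroneckerSum.Conditions A B →
          KroneckerSum.opNorm B ≤ κ * KroneckerSum.tau B →
          c * (KroneckerSum.psi0 C₀ K A B * Real.sqrt (Real.log m / n)) ≤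
            KroneckerSum.deviationBound C₀ K A B) := by
  refine ⟨1200, by norm_num, ?_, ⟨16 + 8 * 1200, by norm_num, ?_⟩, fun κ hκ =>
    ⟨min 1 (1 / √κ), lt_min one_pos (by positivity), ?_⟩⟩
  · intro n m A B K h Ω _ μ _ Z₁ Z₂ h1 h2 h12
    exact h.le_measureReal_maxNorm_le h1 h2 h12
  · intro n m A B K h
    exact h.deviationBound_le (by norm_num) K
  · intro n m A B K h hB
    exact h.le_deviationBound (by norm_num) K hκ hB
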